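/- Let $0<\alpha,\beta\le 1$ and $k\ge 1$. For $\lambda=(\lambda_1,\dots,\lambda_k)$ with all $\lambda_j>0$, a generalized Poisson random field (GPRF) on $\mathbb{R}_+^2$ with rates $\lambda$ is a process $\{M(s,t),\ s,t\ge 0\}$ with values in $\mathbb{N}_0$ and almost surely right-continuous paths such that $M(0,t)=M(s,0)=0$ almost surely, the increments $M(s',t')-M(s',t)-M(s,t')+M(s,t)$ over disjoint rectangles $(s,s']\times(t,t']$ are independent, and such an increment over a rectangle of area $a$ has the law $$\Pr\{\cdot=n\}=\sum_{n_1+2n_2+\dots+kn_k=n}\ \prod_{j=1}^{k}\frac{(\lambda_j a)^{n_j}}{n_j!}e^{-\lambda_j a},\qquad n\ge 0 .$$ For $0<\alpha<1$ let $L^\alpha(t)=\inf\{x\ge 0: H^\alpha(x)\ge t\}$ be an inverse stable subordinator, where $H^\alpha$ is a stable subordinator, $\mathbb{E}e^{-uH^\alpha(t)}=e^{-tu^\alpha}$ for $u>0$; let $L^1(t)=t$. The fractional GPRF with rates $\lambda$ is $M^{\alpha,\beta}(s,t)=M(L^\alpha(s),L^\beta(t))$, where $M$ is a GPRF with rates $\lambda$,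 $L^\alpha$ and $L^\beta$ are inverse stable subordinators of indices $\alpha$ and $\beta$, and these three processes are mutually independent. For $z\in\mathbb{C}$ with $|z|\le 1$ let $G^{\alpha,\beta}(z,s,t)=\mathbb{E}z^{M^{\alpha,\beta}(s,t)}$ (with $0^0=1$); its law being determined by $\lambda$, we also regard $G^{\alpha,\beta}$ as a function of $\lambda\in(0,\infty)^k$. The generalized Wright function is $${}_2\Psi_2\left[\begin{matrix}(a_1,\alpha_1),&(a_2,\alpha_2)\\(b_1,\beta_1),&(b_2,\beta_2)\end{matrix}\,\middle|\,x\right]=\sum_{r=0}^\infty\frac{\Gamma(\alpha_1r+a_1)\Gamma(\alpha_2r+a_2)}{\Gamma(\beta_1r+b_1)\Gamma(\beta_2r+b_2)}\frac{x^r}{r!},$$ wherever this series converges. The Caputo derivative is $\frac{d^\alpha}{dt^\alpha}f(t)=\frac1{\Gamma(1-\alpha)}\int_0^t\frac{f'(x)}{(t-x)^\alpha}\,dx$ for $0<\alpha<1$ and $f'(t)$ for $\alpha=1$. (i) For $s,t\ge 0$ put $x=\sum_{j=1}^k\lambda_j(z^j-1)s^\alpha t^\beta$. Whenever the series on the right-hand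 side converges, $$G^{\alpha,\beta}(z,s,t)={}_2\Psi_2\left[\begin{matrix}(1,1),&(1,1)\\(1,\alpha),&(1,\beta)\end{matrix}\,\middle|\,x\right].$$ The series converges in particular if $\alpha+\beta>1$, and if $\alpha+\beta=1$ and $|x|<\alpha^\alpha\beta^\beta$. (ii) For all $s,t>0$ the derivatives below exist (the Caputo derivative of order $\alpha$ in $s$ is taken first, then that of order $\beta$ in $t$), and $$\frac{\partial^{\alpha+\beta}}{\partial t^\beta\,\partial s^\alpha}G^{\alpha,\beta}(z,s,t)=\sum_{j=1}^k\lambda_j(z^j-1)\,G^{\alpha,\beta}(z,s,t)+\sum_{j=1}^k\sum_{j'=1}^k\lambda_j\lambda_{j'}\sum_{r=1}^{j'}\bigl(z^{j+j'-r}-z^{j'-r}\bigr)\frac{\partial}{\partial\lambda_1}G^{\alpha,\beta}(z,s,t).$$ (iii) $G^{\alpha,\beta}(z,0,t)=G^{\alpha,\beta}(z,s,0)=G^{\alpha,\beta}(z,0,0)=1$ for all $s,t\ge 0$. -/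

import Mathlib

open MeasureTheory ProbabilityTheory Filter Topology
open scoped NNReal

noncomputable section

/-! ### The generalized Wright function -/

/-- The `r`-th term of the series of the generalized Wright function `ₘΨₗ` with upper parameters
`A i = (a_i, α_i)` and lower parameters `B j = (b_j, β_j)`. -/
def genWrightTerm {m l : ℕ} (A : Fin m → ℝ × ℝ) (B : Fin l → ℝ × ℝ) (x : ℂ) (r : ℕ) : ℂ :=
  (((∏ i, Real.Gamma ((A i).2 * r + (A i).1)) /
    ((∏ j, Real.Gamma ((B j).2 * r + (B j).1)) * (r.factorial : ℝ)) : ℝ) : ℂ) * x ^ r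

/-- The series `∑_{r ≥ 0}` of the generalized Wright function converges at `x`, in the ordinary
sense that its partial sums over `r < N` converge as `N → ∞`. -/
def GenWrightConverges {m l : ℕ} (A : Fin m → ℝ × ℝ) (B : Fin l → ℝ × ℝ) (x : ℂ) : Prop :=
  Summable (genWrightTerm A B x) (SummationFilter.conditional ℕ)

/-- The generalized Wright function `ₘΨₗ`, the limit of the partial sums over `r < N`. -/
def genWright {m l : ℕ} (A : Fin m → ℝ × ℝ) (B : Fin l → ℝ × ℝ) (x : ℂ) : ℂ :=
  ∑'[SummationFilter.conditional ℕ] r, genWrightTerm A B x r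

/-! ### The Caputo derivative -/

/-- The Caputo derivative of order `a ∈ (0, 1]` with base point `0`, at the point `t`:
`Γ(1-a)⁻¹ ∫₀ᵗ f'(x) / (t-x)^a dx` for `a < 1` and `f'(t)` for `a = 1`. -/
def caputoDeriv (a : ℝ) (f : ℝ → ℂ) (t : ℝ) : ℂ :=
  if a = 1 then deriv f t
  else ((Real.Gamma (1 - a))⁻¹ : ℝ) * ∫ x in (0 : ℝ)..t, deriv f x / (((t - x) ^ a : ℝ) : ℂ)

/-- The Caputo derivative of order `a ∈ (0, 1]` of `f` at `t` exists: for `a = 1`, `f` is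
differentiable at `t`; for `a < 1`, `f` is continuous on `[0, t]`, differentiable in `(0, t)`, and
the integral that defines the derivative converges absolutely. -/
def CaputoDifferentiableAt (a : ℝ) (f : ℝ → ℂ) (t : ℝ) : Prop :=
  if a = 1 then DifferentiableAt ℝ f t
  else ContinuousOn f (Set.Icc 0 t) ∧ (∀ x ∈ Set.Ioo 0 t, DifferentiableAt ℝ f x) ∧
    IntervalIntegrable (fun x => deriv f x / (((t - x) ^ a : ℝ) : ℂ)) volume 0 t

/-! ### The generalized Poisson random field on the quadrant -/

/-- `Θ(k, n)`, the set of all `(n_1, …, n_k) ∈ ℕ₀ᵏ` with `∑ j n_j = n`. The index `j : Fin k` stands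
for `j + 1 ∈ {1, …, k}`; the constraint forces `n_j ≤ n`. -/
def gprfTheta (k n : ℕ) : Finset (Fin k → ℕ) :=
  (Fintype.piFinset fun _ => Finset.range (n + 1)).filter fun v =>
    ∑ j : Fin k, ((j : ℕ) + 1) * v j = n

/-- The probability of the value `n` for a rectangle of area `a`:
`∑_{Θ(k,n)} ∏_j (λ_j a)^{n_j} e^{-λ_j a} / n_j!`. -/
def gprfProb {k : ℕ} (l : Fin k → ℝ) (a : ℝ) (n : ℕ) : ℝ :=
  ∑ v ∈ gprfTheta k n, ∏ j, (l j * a) ^ v j / ((v j).factorial : ℝ) * Real.exp (-(l j * a))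

/-- The increment of `M` over the rectangle `(p.1, q.1] × (p.2, q.2]`. -/
def rectIncr {Ω : Type*} (M : ℝ≥0 → ℝ≥0 → Ω → ℕ) (p q : ℝ≥0 × ℝ≥0) (ω : Ω) : ℤ :=
  (M q.1 q.2 ω : ℤ) - M q.1 p.2 ω - M p.1 q.2 ω + M p.1 p.2 ω

/-- `M` is a two-parameter generalized Poisson random field with rates `l`: it vanishes on the axes,
its increments over rectangles have the law `gprfProb`, its increments over disjoint rectangles are
independent, and (being the counting process `M(s,t) = M([0,s] × [0,t])` of a random measure) it has
right-continuous paths. -/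
structure IsGPRF {Ω : Type*} [MeasurableSpace Ω] {k : ℕ} (l : Fin k → ℝ)
    (M : ℝ≥0 → ℝ≥0 → Ω → ℕ) (P : Measure Ω) : Prop where
  measurable : ∀ s t, Measurable (M s t)
  zero_left : ∀ t, ∀ᵐ ω ∂P, M 0 t ω = 0
  zero_right : ∀ s, ∀ᵐ ω ∂P, M s 0 ω = 0
  law_incr : ∀ p q : ℝ≥0 × ℝ≥0, p.1 < q.1 → p.2 < q.2 → ∀ n : ℕ,
    P.real {ω | rectIncr M p q ω = n} =
      gprfProb l (((q.1 : ℝ) - p.1) * ((q.2 : ℝ) - p.2)) n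
  indep_incr : ∀ (m : ℕ) (p q : Fin m → ℝ≥0 × ℝ≥0), (∀ i, p i ≤ q i) →
    Pairwise (fun i i' => Disjoint
      (Set.Ioc (p i).1 (q i).1 ×ˢ Set.Ioc (p i).2 (q i).2)
      (Set.Ioc (p i').1 (q i').1 ×ˢ Set.Ioc (p i').2 (q i').2)) →
    iIndepFun (fun i => rectIncr M (p i) (q i)) P
  right_cont : ∀ᵐ ω ∂P, ∀ p : ℝ≥0 × ℝ≥0,
    ContinuousWithinAt (fun q : ℝ≥0 × ℝ≥0 => M q.1 q.2 ω) (Set.Ici p) p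

/-! ### Inverse stable subordinators -/

/-- A real-valued Lévy process indexed by `[0, ∞)`. -/
structure IsLevyProcess {Ω : Type*} [MeasurableSpace Ω] (H : ℝ≥0 → Ω → ℝ) (P : Measure Ω) :
    Prop where
  measurable : ∀ t, Measurable (H t)
  zero : ∀ᵐ ω ∂P, H 0 ω = 0
  indep_incr : HasIndepIncrements H P
  stationary_incr : ∀ s t, IdentDistrib (fun ω => H (s + t) ω - H s ω) (H t) P P
  right_cont : ∀ᵐ ω ∂P, ∀ t, ContinuousWithinAt (fun x => H x ω) (Set.Ici t) t
  left_lim : ∀ᵐ ω ∂P, ∀ t, ∃ y : ℝ, Tendsto (fun x => H x ω) (𝓝[<] t) (𝓝 y)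

/-- A stable subordinator of index `a ∈ (0, 1)`: a Lévy process with values in `[0, ∞)` and
nondecreasing paths, such that `E exp(-u H(t)) = exp(-t u^a)` for `u > 0`. -/
structure IsStableSubordinator {Ω : Type*} [MeasurableSpace Ω] (a : ℝ) (H : ℝ≥0 → Ω → ℝ)
    (P : Measure Ω) : Prop where
  levy : IsLevyProcess H P
  nonneg : ∀ᵐ ω ∂P, ∀ t, 0 ≤ H t ω
  mono : ∀ᵐ ω ∂P, Monotone fun t => H t ω
  laplace : ∀ (u : ℝ) (t : ℝ≥0), 0 < u →
    ∫ ω, Real.exp (-(u * H t ω)) ∂P = Real.exp (-(t * u ^ a))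

/-- An inverse stable subordinator of index `a ∈ (0, 1]`: for `a < 1` the hitting time process
`L(t) = inf {x ≥ 0 : H(x) ≥ t}` of a stable subordinator `H` of index `a`; for `a = 1`,
`L(t) = t`. -/
def IsInverseStableSubordinator {Ω : Type*} [MeasurableSpace Ω] (a : ℝ) (L : ℝ≥0 → Ω → ℝ≥0)
    (P : Measure Ω) : Prop :=
  (∀ t, Measurable (L t)) ∧
  if a = 1 then ∀ t, ∀ᵐ ω ∂P, L t ω = t
  else ∃ H : ℝ≥0 → Ω → ℝ, IsStableSubordinator a H P ∧
    ∀ t, ∀ᵐ ω ∂P, L t ω = sInf {x : ℝ≥0 | (t : ℝ) ≤ H x ω}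

/-! ### The fractional generalized Poisson random field -/

/-- `X` is a fractional generalized Poisson random field of orders `a`, `b` with rates `l`:
`X(s,t) = M(L₁(s), L₂(t))`, where the field `M` and the inverse stable subordinators `L₁`, `L₂` of
indices `a`, `b` are mutually independent processes (the last two conditions together). -/
def IsFGPRF {Ω : Type*} [MeasurableSpace Ω] {k : ℕ} (a b : ℝ) (l : Fin k → ℝ)
    (X : ℝ≥0 → ℝ≥0 → Ω → ℕ) (P : Measure Ω) : Prop :=
  ∃ (M : ℝ≥0 → ℝ≥0 → Ω → ℕ) (L₁ L₂ : ℝ≥0 → Ω → ℝ≥0),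
    IsGPRF l M P ∧ IsInverseStableSubordinator a L₁ P ∧ IsInverseStableSubordinator b L₂ P ∧
    IndepFun (fun ω t => L₁ t ω) (fun ω t => L₂ t ω) P ∧
    IndepFun (fun ω (p : ℝ≥0 × ℝ≥0) => M p.1 p.2 ω) (fun ω => (fun t => L₁ t ω, fun t => L₂ t ω)) P ∧
    ∀ s t ω, X s t ω = M (L₁ s ω) (L₂ t ω) ω

/-- The probability generating function `E z^{X(s,t)}` of a two-parameter process, written as a
function of real `s`, `t`; only `s, t ≥ 0` matters. -/
def pgf {Ω : Type*} [MeasurableSpace Ω] (X : ℝ≥0 → ℝ≥0 → Ω → ℕ) (P : Measure Ω)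
    (z : ℂ) (s t : ℝ) : ℂ :=
  ∫ ω, z ^ X s.toNNReal t.toNNReal ω ∂P

end

/-! Everything rests on a mixture formula. An inverse stable subordinator at time `s` has the law of
`s ^ a * A`, where `A` has moments `n! / Γ(a n + 1)` (`IsStableSubordinator.map_sInf_eq`,
`IsStableSubordinator.isMittagLefflerLaw`). Given the two times, the field has generating function
`exp(c L₁ L₂)` with `c = ∑ λ_j (z^j - 1)` and `Re c ≤ 0`. Hence `G = E exp(c s^α t^β A B)` with `A`,
`B` independent (`IsFGPRF.exists_laws`), and only the laws of `A` and `B` matter afterwards.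

Expanding the exponential in moments of `A B` gives the Wright series where it converges absolutely;
mere convergence is handled by Abel's limit theorem (`integral_cexp_eq_genWright`).

For the equation, the key fact is that the Caputo derivative of `σ ↦ E Ψ(σ^a A)` is `E Ψ'(σ^a A)`
(`caputo_integral_comp`). The substitution `v = s u` turns the Caputo kernel into a Beta(`a`, `1 -
a`) density, and the identity `E [Γ(a+1) A g(U^a A)] = E g(A)` (`integral_beta_prod`) is checked on
moments. Applied in `s` and then in `t`, it yields `c G + c² s^α t^β E [A B exp(c s^α t^β A B)]`. On
the other hand `∂G/∂λ₁ = (z - 1) s^α t^β E [A B exp(…)]`, and the double sum of the equation times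
`z - 1` is `c²` (`sum_sum_mul_sub_one_eq_sq`). -/

noncomputable section

/-! ### Measures determined by their moments -/

/-- Tonelli for the exponential series, whose terms are nonnegative. -/
theorem integrable_exp_mul_of_summable_moments {Ω : Type*} [MeasurableSpace Ω] {μ : Measure Ω}
    {Y : Ω → ℝ} (h0 : ∀ᵐ ω ∂μ, 0 ≤ Y ω) (hint : ∀ n : ℕ, Integrable (fun ω => Y ω ^ n) μ)
    {K : ℝ} (hK : 0 ≤ K) (hs : Summable fun n : ℕ => K ^ n / (n.factorial : ℝ) * ∫ ω, Y ω ^ n ∂μ) :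
    Integrable (fun ω => Real.exp (K * Y ω)) μ := by
  have hY : AEMeasurable Y μ := by simpa using (hint 1).aemeasurable
  have hexp : ∀ y : ℝ, HasSum (fun n : ℕ => K ^ n / (n.factorial : ℝ) * y ^ n)
      (Real.exp (K * y)) := by
    intro y
    have := NormedSpace.expSeries_div_hasSum_exp (𝔸 := ℝ) (K * y)
    rw [← Real.exp_eq_exp_ℝ] at this
    refine this.congr_fun ?_
    intro n
    rw [mul_pow]; ring
  refine ⟨by fun_prop, ?_⟩
  rw [hasFiniteIntegral_iff_ofReal (ae_of_all _ fun ω => (Real.exp_pos _).le)]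
  calc ∫⁻ ω, ENNReal.ofReal (Real.exp (K * Y ω)) ∂μ
      = ∫⁻ ω, ∑' n : ℕ, ENNReal.ofReal (K ^ n / (n.factorial : ℝ) * Y ω ^ n) ∂μ := by
        refine lintegral_congr_ae (h0.mono fun ω hω => ?_)
        dsimp only
        rw [← (hexp (Y ω)).tsum_eq, ENNReal.ofReal_tsum_of_nonneg (fun n => by positivity)
          (hexp (Y ω)).summable]
    _ = ∑' n : ℕ, ∫⁻ ω, ENNReal.ofReal (K ^ n / (n.factorial : ℝ) * Y ω ^ n) ∂μ :=
        lintegral_tsum fun n => by fun_prop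
    _ = ∑' n : ℕ, ENNReal.ofReal (K ^ n / (n.factorial : ℝ) * ∫ ω, Y ω ^ n ∂μ) := by
        congr 1; ext n
        rw [← integral_const_mul, ofReal_integral_eq_lintegral_ofReal ((hint n).const_mul _)
          (h0.mono fun ω hω => by positivity)]
    _ < ⊤ := hs.tsum_ofReal_lt_top

theorem hasSum_moments_integral_cexp {Ω : Type*} [MeasurableSpace Ω] {μ : Measure Ω}
    {Y : Ω → ℝ} (h0 : ∀ᵐ ω ∂μ, 0 ≤ Y ω) (hint : ∀ n : ℕ, Integrable (fun ω => Y ω ^ n) μ)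
    {w : ℂ} (hs : Summable fun n : ℕ => ‖w‖ ^ n / (n.factorial : ℝ) * ∫ ω, Y ω ^ n ∂μ) :
    HasSum (fun n : ℕ => w ^ n / (n.factorial : ℂ) * ((∫ ω, Y ω ^ n ∂μ : ℝ) : ℂ))
      (∫ ω, Complex.exp (w * Y ω) ∂μ) := by
  have hexp : ∀ y : ℝ, ∑' n : ℕ, w ^ n / (n.factorial : ℂ) * ((y ^ n : ℝ) : ℂ) =
      Complex.exp (w * y) := by
    intro y
    have := NormedSpace.expSeries_div_hasSum_exp (𝔸 := ℂ) (w * y)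
    rw [← Complex.exp_eq_exp_ℂ] at this
    rw [← this.tsum_eq]
    congr 1; ext n
    push_cast; rw [mul_pow]; ring
  have key := hasSum_integral_of_summable_integral_norm (μ := μ)
    (F := fun (n : ℕ) ω => w ^ n / (n.factorial : ℂ) * ((Y ω ^ n : ℝ) : ℂ))
    (fun n => ((hint n).ofReal).const_mul _) ?_
  · simp_rw [hexp] at key
    refine key.congr_fun fun n => ?_
    rw [integral_const_mul, integral_complex_ofReal]
  · refine hs.congr fun n => ?_
    rw [← integral_const_mul]
    refine integral_congr_ae (h0.mono fun ω hω => ?_)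
    simp only [norm_mul, norm_div, norm_pow, Complex.norm_real, Complex.norm_natCast,
      Real.norm_eq_abs]
    rw [abs_of_nonneg hω]

/-- Summability for every `K` makes each characteristic function equal to its moment series on the
whole line, so no analytic continuation is needed. -/
theorem MeasureTheory.Measure.ext_of_moments {μ ν : Measure ℝ} [IsFiniteMeasure μ]
    [IsFiniteMeasure ν] (hμ : ∀ᵐ x ∂μ, 0 ≤ x) (hν : ∀ᵐ x ∂ν, 0 ≤ x)
    (hiμ : ∀ n : ℕ, Integrable (fun x : ℝ => x ^ n) μ)
    (hiν : ∀ n : ℕ, Integrable (fun x : ℝ => x ^ n) ν)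
    (h : ∀ n : ℕ, ∫ x, x ^ n ∂μ = ∫ x, x ^ n ∂ν)
    (hs : ∀ K : ℝ, 0 ≤ K → Summable fun n : ℕ => K ^ n / (n.factorial : ℝ) * ∫ x, x ^ n ∂μ) :
    μ = ν := by
  refine Measure.ext_of_charFun ?_
  ext t
  rw [charFun_apply_real, charFun_apply_real]
  have e : ∀ x : ℝ, (t : ℂ) * x * Complex.I = (t * Complex.I) * x := fun x => by ring
  simp_rw [e]
  have h1 := hasSum_moments_integral_cexp hμ hiμ (w := t * Complex.I) (hs _ (norm_nonneg _))
  have h2 := hasSum_moments_integral_cexp hν hiν (w := t * Complex.I)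
    (by simp_rw [← h]; exact hs _ (norm_nonneg _))
  simp_rw [← h] at h2
  exact h1.unique h2

/-- Probability measures on `[0, ∞)` are determined by their Laplace transforms. -/
theorem MeasureTheory.Measure.ext_of_laplace {μ ν : Measure ℝ} [IsProbabilityMeasure μ]
    [IsProbabilityMeasure ν] (hμ : ∀ᵐ x ∂μ, 0 ≤ x) (hν : ∀ᵐ x ∂ν, 0 ≤ x)
    (h : ∀ u : ℝ, 0 < u → ∫ x, Real.exp (-(u * x)) ∂μ = ∫ x, Real.exp (-(u * x)) ∂ν) :
    μ = ν := by
  have hm : Measurable fun x : ℝ => Real.exp (-x) := by fun_prop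
  have hpow : ∀ (n : ℕ) (x : ℝ), Real.exp (-x) ^ n = Real.exp (-(n * x)) := by
    intro n x; rw [← Real.exp_nat_mul]; ring_nf
  have hint : ∀ (ρ : Measure ℝ) [IsProbabilityMeasure ρ], (∀ᵐ x ∂ρ, 0 ≤ x) → ∀ n : ℕ,
      Integrable (fun x : ℝ => x ^ n) (ρ.map fun x => Real.exp (-x)) := by
    intro ρ _ hρ n
    rw [integrable_map_measure (by fun_prop) hm.aemeasurable]
    refine Integrable.of_bound (by fun_prop) 1 (hρ.mono fun x hx => ?_)
    simp only [Function.comp_apply, norm_pow, Real.norm_eq_abs, Real.abs_exp]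
    exact pow_le_one₀ (Real.exp_pos _).le (by simpa using hx)
  have hmom : ∀ (ρ : Measure ℝ) (n : ℕ),
      ∫ x, x ^ n ∂(ρ.map fun x => Real.exp (-x)) = ∫ x, Real.exp (-(n * x)) ∂ρ := by
    intro ρ n
    rw [integral_map hm.aemeasurable (by fun_prop)]
    simp_rw [hpow]
  have hnn : ∀ ρ : Measure ℝ, ∀ᵐ x ∂(ρ.map fun x => Real.exp (-x)), 0 ≤ x := by
    intro ρ
    rw [ae_map_iff hm.aemeasurable measurableSet_Ici]
    exact ae_of_all _ fun x => (Real.exp_pos _).le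
  have : IsProbabilityMeasure (μ.map fun x => Real.exp (-x)) :=
    Measure.isProbabilityMeasure_map hm.aemeasurable
  have : IsProbabilityMeasure (ν.map fun x => Real.exp (-x)) :=
    Measure.isProbabilityMeasure_map hm.aemeasurable
  have key : (μ.map fun x => Real.exp (-x)) = ν.map fun x => Real.exp (-x) := by
    refine Measure.ext_of_moments (hnn μ) (hnn ν) (hint μ hμ) (hint ν hν) ?_ ?_
    · intro n
      rw [hmom, hmom]
      rcases Nat.eq_zero_or_pos n with rfl | hn
      · simp
      · exact h n (by exact_mod_cast hn)
    · intro K hK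
      refine Summable.of_nonneg_of_le (fun n => ?_) (fun n => ?_) (Real.summable_pow_div_factorial K)
      · rw [hmom]
        exact mul_nonneg (by positivity) (integral_nonneg fun _ => (Real.exp_pos _).le)
      · refine mul_le_of_le_one_right (by positivity) ?_
        have h1 : ∫ x, x ^ n ∂(μ.map fun x => Real.exp (-x)) ≤
            ∫ x, (1 : ℝ) ∂(μ.map fun x => Real.exp (-x)) := by
          refine integral_mono_ae (hint μ hμ n) (integrable_const _) ?_
          rw [EventuallyLE, ae_map_iff hm.aemeasurable
            (measurableSet_le (by fun_prop) (by fun_prop))]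
          exact hμ.mono fun x hx => pow_le_one₀ (Real.exp_pos _).le (by simpa using hx)
        simpa using h1
  have hinv : ∀ ρ : Measure ℝ, (ρ.map fun x => Real.exp (-x)).map (fun y => -Real.log y) = ρ := by
    intro ρ
    rw [Measure.map_map (by fun_prop) hm]
    simp [Function.comp_def]
  rw [← hinv μ, key, hinv]

/-! ### Growth of the Gamma function -/

/-- On `(v, ∞)` the integrand of Gamma is at least `exp(-x) v^y`. The free parameter serves twice: a
fixed `v` shows that Gamma outgrows every geometric sequence, and `v = y` gives the Stirling-type
bound `(y/e)^y`. -/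
theorem exp_neg_mul_rpow_le_Gamma {v y : ℝ} (hv : 0 ≤ v) (hy : 0 ≤ y) :
    Real.exp (-v) * v ^ y ≤ Real.Gamma (y + 1) := by
  have hG := Real.GammaIntegral_convergent (s := y + 1) (by linarith)
  rw [Real.Gamma_eq_integral (by linarith)]
  have h1 : ∫ x in Set.Ioi v, Real.exp (-x) * v ^ y ≤
      ∫ x in Set.Ioi v, Real.exp (-x) * x ^ (y + 1 - 1) := by
    refine setIntegral_mono_on ((integrableOn_exp_neg_Ioi v).mul_const _)
      (hG.mono_set (Set.Ioi_subset_Ioi hv)) measurableSet_Ioi fun x hx => ?_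
    have hx' : v < x := hx
    rw [add_sub_cancel_right]
    gcongr
  rw [integral_mul_const, integral_exp_neg_Ioi] at h1
  refine h1.trans (setIntegral_mono_set hG ?_ (Set.Ioi_subset_Ioi hv).eventuallyLE)
  filter_upwards [ae_restrict_mem measurableSet_Ioi] with x hx
  have : (0 : ℝ) < x := hx
  simp only [Pi.zero_apply]; positivity

theorem summable_pow_div_Gamma {a K : ℝ} (ha : 0 < a) (hK : 0 ≤ K) :
    Summable fun n : ℕ => K ^ n / Real.Gamma (a * n + 1) := by
  -- Chosen so that `v ^ a = 2K + 1`; the comparison series is then geometric with ratio `K / (2K +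
  -- 1) < 1`.
  set v : ℝ := (2 * K + 1) ^ (1 / a) with hv
  have hv0 : 0 < v := by positivity
  have hva : v ^ a = 2 * K + 1 := by
    rw [hv, ← Real.rpow_mul (by positivity)]; field_simp; simp
  have hr : K / (2 * K + 1) < 1 := by rw [div_lt_one (by positivity)]; linarith
  refine Summable.of_nonneg_of_le (fun n => ?_) (fun n => ?_)
    ((summable_geometric_of_lt_one (by positivity) hr).mul_left (Real.exp v))
  · have := Real.Gamma_pos_of_pos (show 0 < a * n + 1 by positivity)
    positivity
  · have h := exp_neg_mul_rpow_le_Gamma hv0.le (show 0 ≤ a * n by positivity)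
    rw [Real.rpow_mul hv0.le, hva, Real.rpow_natCast] at h
    calc K ^ n / Real.Gamma (a * n + 1) ≤ K ^ n / (Real.exp (-v) * (2 * K + 1) ^ n) := by gcongr
      _ = Real.exp v * (K / (2 * K + 1)) ^ n := by
        rw [Real.exp_neg, div_pow]; field_simp

/-! ### The Mittag-Leffler law -/

/-- The law on `[0, ∞)` with the moments `n! / Γ(a n + 1)`: that of an inverse stable subordinator
of index `a` at time `1`. -/
structure IsMittagLefflerLaw (a : ℝ) (μ : Measure ℝ) : Prop where
  isProbabilityMeasure : IsProbabilityMeasure μ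
  nonneg : ∀ᵐ x ∂μ, 0 ≤ x
  integrable_pow : ∀ n : ℕ, Integrable (fun x : ℝ => x ^ n) μ
  moment : ∀ n : ℕ, ∫ x, x ^ n ∂μ = n.factorial / Real.Gamma (a * n + 1)

namespace IsMittagLefflerLaw

variable {a : ℝ} {μ ν : Measure ℝ}

theorem summable_moments (h : IsMittagLefflerLaw a μ) (ha : 0 < a) {K : ℝ} (hK : 0 ≤ K) :
    Summable fun n : ℕ => K ^ n / (n.factorial : ℝ) * ∫ x, x ^ n ∂μ := by
  refine (summable_pow_div_Gamma ha hK).congr fun n => ?_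
  have : (n.factorial : ℝ) ≠ 0 := by positivity
  rw [h.moment]; field_simp

theorem unique (hμ : IsMittagLefflerLaw a μ) (hν : IsMittagLefflerLaw a ν) (ha : 0 < a) :
    μ = ν := by
  have := hμ.isProbabilityMeasure
  have := hν.isProbabilityMeasure
  exact Measure.ext_of_moments hμ.nonneg hν.nonneg hμ.integrable_pow hν.integrable_pow
    (fun n => by rw [hμ.moment, hν.moment]) fun K hK => hμ.summable_moments ha hK

theorem integrableExpSet_eq (h : IsMittagLefflerLaw a μ) (ha : 0 < a) :
    integrableExpSet id μ = Set.univ := by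
  refine Set.eq_univ_of_forall fun K => ?_
  have := integrable_exp_mul_of_summable_moments h.nonneg h.integrable_pow (abs_nonneg K)
    (h.summable_moments ha (abs_nonneg K))
  refine Integrable.mono' this (by fun_prop) (h.nonneg.mono fun x hx => ?_)
  simp only [id, Real.norm_eq_abs, Real.abs_exp]
  exact Real.exp_le_exp.2 (mul_le_mul_of_nonneg_right (le_abs_self K) hx)

end IsMittagLefflerLaw

theorem isMittagLefflerLaw_dirac_one : IsMittagLefflerLaw 1 (Measure.dirac 1) where
  isProbabilityMeasure := inferInstance
  nonneg := by
    exact (ae_dirac_iff (measurableSet_Ici (a := (0 : ℝ)))).2 (zero_le_one' ℝ)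
  integrable_pow n := integrable_dirac (by simp)
  moment n := by
    have : (n.factorial : ℝ) ≠ 0 := by positivity
    simp [Real.Gamma_nat_eq_factorial, this]

/-! ### The law of an inverse stable subordinator -/

namespace IsStableSubordinator

variable {Ω : Type*} [MeasurableSpace Ω] {P : Measure Ω} {a : ℝ} {H : ℝ≥0 → Ω → ℝ}

theorem measurable (hH : IsStableSubordinator a H P) (x : ℝ≥0) : Measurable (H x) :=
  hH.levy.measurable x

variable [IsProbabilityMeasure P]

theorem integrable_exp_neg (hH : IsStableSubordinator a H P) {u : ℝ} (hu : 0 ≤ u) (x : ℝ≥0) :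
    Integrable (fun ω => Real.exp (-(u * H x ω))) P := by
  have := hH.measurable x
  refine Integrable.of_bound (by fun_prop) 1 (hH.nonneg.mono fun ω hω => ?_)
  rw [Real.norm_eq_abs, Real.abs_exp, Real.exp_le_one_iff]
  have := mul_nonneg hu (hω x)
  linarith

/-- Self-similarity: both variables have Laplace transform `exp(-x u^a)`. -/
theorem map_eq_map_rpow_mul (hH : IsStableSubordinator a H P) (ha : 0 < a) (x : ℝ≥0) :
    P.map (H x) = P.map fun ω => (x : ℝ) ^ a⁻¹ * H 1 ω := by
  have h1 := hH.measurable 1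
  have hx := hH.measurable x
  have hm : Measurable fun ω => (x : ℝ) ^ a⁻¹ * H 1 ω := by fun_prop
  have := Measure.isProbabilityMeasure_map (μ := P) hx.aemeasurable
  have := Measure.isProbabilityMeasure_map (μ := P) hm.aemeasurable
  refine Measure.ext_of_laplace ?_ ?_ fun u hu => ?_
  · rw [ae_map_iff hx.aemeasurable measurableSet_Ici]
    exact hH.nonneg.mono fun ω hω => hω x
  · rw [ae_map_iff hm.aemeasurable measurableSet_Ici]
    exact hH.nonneg.mono fun ω hω => mul_nonneg (by positivity) (hω 1)
  · rw [integral_map hx.aemeasurable (by fun_prop), integral_map hm.aemeasurable (by fun_prop),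
      hH.laplace u x hu]
    rcases eq_or_ne x 0 with rfl | hx0
    · simp [Real.zero_rpow (inv_ne_zero ha.ne')]
    · have hx' : (0 : ℝ) < x := by positivity
      have := hH.laplace (u * (x : ℝ) ^ a⁻¹) 1 (by positivity)
      simp_rw [mul_assoc] at this
      rw [this, Real.mul_rpow hu.le (by positivity), ← Real.rpow_mul hx'.le,
        inv_mul_cancel₀ ha.ne']
      congr 1; simp [mul_comm]

/-- By Markov, `P(H 1 ≤ 0) ≤ E exp(-u H 1) = exp(-u^a)`, and `u → ∞`. -/
theorem ae_pos (hH : IsStableSubordinator a H P) (ha : 0 < a) : ∀ᵐ ω ∂P, 0 < H 1 ω := by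
  have hle : ∀ n : ℕ, P.real {ω | H 1 ω ≤ 0} ≤ Real.exp (-((n : ℝ) + 1) ^ a) := by
    intro n
    have hn : (0 : ℝ) < (n : ℝ) + 1 := by positivity
    have h := mul_meas_ge_le_integral_of_nonneg
      (ae_of_all P fun ω => (Real.exp_pos (-(((n : ℝ) + 1) * H 1 ω))).le)
      (hH.integrable_exp_neg hn.le 1) 1
    rw [hH.laplace _ _ hn, one_mul] at h
    simp only [NNReal.coe_one, one_mul] at h
    refine le_trans (measureReal_mono fun ω hω => ?_) h
    have : H 1 ω ≤ 0 := hω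
    simp only [Set.mem_ofPred_eq, Real.one_le_exp_iff]
    nlinarith
  have hlim : Tendsto (fun n : ℕ => Real.exp (-((n : ℝ) + 1) ^ a)) atTop (𝓝 0) := by
    refine Real.tendsto_exp_neg_atTop_nhds_zero.comp ((tendsto_rpow_atTop ha).comp ?_)
    exact tendsto_atTop_add_const_right _ _ tendsto_natCast_atTop_atTop
  have h0 : P.real {ω | H 1 ω ≤ 0} = 0 :=
    le_antisymm (ge_of_tendsto' hlim hle) measureReal_nonneg
  rw [measureReal_eq_zero_iff] at h0
  rw [ae_iff]
  simpa using h0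

/-- Markov's inequality gives `P(H n ≤ s) ≤ e^s e^{-n}`. This excludes an empty set of passage
times, whose `sInf` would be the default value `0`. -/
theorem ae_exists_le (hH : IsStableSubordinator a H P) (s : ℝ) :
    ∀ᵐ ω ∂P, ∃ y, s ≤ H y ω := by
  have hle : ∀ n : ℕ, P.real {ω | ∀ y, H y ω < s} ≤ Real.exp s * Real.exp (-(n : ℝ)) := by
    intro n
    have h := mul_meas_ge_le_integral_of_nonneg
      (ae_of_all P fun ω => (Real.exp_pos (-(1 * H n ω))).le)
      (hH.integrable_exp_neg zero_le_one n) (Real.exp (-s))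
    rw [hH.laplace _ _ one_pos] at h
    simp only [NNReal.coe_natCast, Real.one_rpow, mul_one] at h
    rw [Real.exp_neg, inv_mul_le_iff₀ (Real.exp_pos _)] at h
    refine le_trans (measureReal_mono fun ω hω => ?_) h
    have : H n ω < s := hω n
    simp only [Set.mem_ofPred_eq, ← Real.exp_neg, Real.exp_le_exp]
    linarith
  have hlim : Tendsto (fun n : ℕ => Real.exp s * Real.exp (-(n : ℝ))) atTop (𝓝 0) := by
    simpa using (Real.tendsto_exp_neg_atTop_nhds_zero.comp
      tendsto_natCast_atTop_atTop).const_mul (Real.exp s)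
  have h0 : P.real {ω | ∀ y, H y ω < s} = 0 :=
    le_antisymm (ge_of_tendsto' hlim hle) measureReal_nonneg
  rw [measureReal_eq_zero_iff] at h0
  rw [ae_iff]
  simpa using h0

/-- Negative moments come from the Laplace transform: write `Γ(ar) y^{-ar}` as `∫ u^{ar-1} e^{-uy}
du`, exchange by Tonelli, and evaluate `∫ u^{ar-1} exp(-u^a) du`. With lower integrals,
integrability is a consequence and not a premise. -/
theorem lintegral_rpow_neg (hH : IsStableSubordinator a H P) (ha : 0 < a) {r : ℝ} (hr : 0 < r) :
    ∫⁻ ω, ENNReal.ofReal (Real.Gamma (a * r) * H 1 ω ^ (-(a * r))) ∂P =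
      ENNReal.ofReal (1 / a * Real.Gamma r) := by
  have h1 := hH.measurable 1
  have har : 0 < a * r := mul_pos ha hr
  calc ∫⁻ ω, ENNReal.ofReal (Real.Gamma (a * r) * H 1 ω ^ (-(a * r))) ∂P
      = ∫⁻ ω, (∫⁻ u in Set.Ioi (0 : ℝ),
          ENNReal.ofReal (u ^ (a * r - 1) * Real.exp (-(u * H 1 ω)))) ∂P := by
        refine lintegral_congr_ae ((hH.ae_pos ha).mono fun ω hω => ?_)
        have h := Real.integral_rpow_mul_exp_neg_mul_Ioi har hω
        simp_rw [mul_comm (H 1 ω)] at h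
        have hpos : 0 < Real.Gamma (a * r) * H 1 ω ^ (-(a * r)) := by
          have := Real.Gamma_pos_of_pos har
          positivity
        have hval : ∫ u in Set.Ioi (0 : ℝ), u ^ (a * r - 1) * Real.exp (-(u * H 1 ω)) =
            Real.Gamma (a * r) * H 1 ω ^ (-(a * r)) := by
          rw [h, Real.rpow_neg hω.le, one_div, Real.inv_rpow hω.le, mul_comm]
        dsimp only
        rw [← hval, ofReal_integral_eq_lintegral_ofReal]
        · refine Integrable.of_integral_ne_zero ?_
          rw [hval]; exact hpos.ne'
        · filter_upwards [ae_restrict_mem measurableSet_Ioi] with u hu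
          have : (0 : ℝ) < u := hu
          simp only [Pi.zero_apply]; positivity
    _ = ∫⁻ u in Set.Ioi (0 : ℝ), ∫⁻ ω,
          ENNReal.ofReal (u ^ (a * r - 1) * Real.exp (-(u * H 1 ω))) ∂P := by
        refine lintegral_lintegral_swap ?_
        have : Measurable fun p : Ω × ℝ => H 1 p.1 := h1.comp measurable_fst
        fun_prop
    _ = ∫⁻ u in Set.Ioi (0 : ℝ), ENNReal.ofReal (u ^ (a * r - 1) * Real.exp (-u ^ a)) := by
        refine setLIntegral_congr_fun measurableSet_Ioi fun u hu => ?_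
        have hu' : (0 : ℝ) < u := hu
        have := hH.laplace u 1 hu'
        simp only [NNReal.coe_one, one_mul] at this
        rw [← this, ← integral_const_mul, ofReal_integral_eq_lintegral_ofReal
          ((hH.integrable_exp_neg hu'.le 1).const_mul _)]
        exact ae_of_all _ fun ω => by simp only [Pi.zero_apply]; positivity
    _ = ENNReal.ofReal (1 / a * Real.Gamma r) := by
        have hval := integral_rpow_mul_exp_neg_rpow ha (q := a * r - 1) (by linarith)
        rw [show (a * r - 1 + 1) / a = r by field_simp; ring] at hval
        rw [← hval, ofReal_integral_eq_lintegral_ofReal]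
        · refine Integrable.of_integral_ne_zero ?_
          rw [hval]
          have := Real.Gamma_pos_of_pos hr
          positivity
        · filter_upwards [ae_restrict_mem measurableSet_Ioi] with u hu
          have : (0 : ℝ) < u := hu
          simp only [Pi.zero_apply]; positivity

theorem isMittagLefflerLaw (hH : IsStableSubordinator a H P) (ha : 0 < a) :
    IsMittagLefflerLaw a (P.map fun ω => H 1 ω ^ (-a)) := by
  have h1 := hH.measurable 1
  have hm : Measurable fun ω => H 1 ω ^ (-a) := by fun_prop
  have key : ∀ n : ℕ, Integrable (fun ω => (H 1 ω ^ (-a)) ^ n) P ∧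
      ∫ ω, (H 1 ω ^ (-a)) ^ n ∂P = n.factorial / Real.Gamma (a * n + 1) := by
    intro n
    -- The case `n = 0` is apart because `Γ(a n)` would sit at a pole.
    rcases n.eq_zero_or_pos with rfl | hn
    · simp
    have hn' : (0 : ℝ) < n := by exact_mod_cast hn
    have han : 0 < a * n := by positivity
    have hG := Real.Gamma_pos_of_pos han
    have hL := hH.lintegral_rpow_neg ha hn'
    have hms : Measurable fun ω => Real.Gamma (a * n) * H 1 ω ^ (-(a * n)) :=
      (h1.pow_const _).const_mul _
    have hnn : ∀ᵐ ω ∂P, 0 ≤ Real.Gamma (a * n) * H 1 ω ^ (-(a * n)) :=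
      hH.nonneg.mono fun ω hω => mul_nonneg hG.le (Real.rpow_nonneg (hω 1) _)
    have hI : Integrable (fun ω => Real.Gamma (a * n) * H 1 ω ^ (-(a * n))) P := by
      refine ⟨hms.aestronglyMeasurable, ?_⟩
      rw [hasFiniteIntegral_iff_ofReal hnn, hL]
      exact ENNReal.ofReal_lt_top
    have hV : ∫ ω, Real.Gamma (a * n) * H 1 ω ^ (-(a * n)) ∂P = 1 / a * Real.Gamma n := by
      rw [integral_eq_lintegral_of_nonneg_ae hnn hms.aestronglyMeasurable, hL, ENNReal.toReal_ofReal]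
      have := Real.Gamma_pos_of_pos hn'
      positivity
    have hpow : ∀ᵐ ω ∂P, (Real.Gamma (a * n))⁻¹ * (Real.Gamma (a * n) * H 1 ω ^ (-(a * n))) =
        (H 1 ω ^ (-a)) ^ n := by
      refine hH.nonneg.mono fun ω hω => ?_
      rw [inv_mul_cancel_left₀ hG.ne', ← neg_mul, Real.rpow_mul (hω 1), Real.rpow_natCast]
    refine ⟨(hI.const_mul _).congr hpow, ?_⟩
    rw [← integral_congr_ae hpow, integral_const_mul, hV, Real.Gamma_add_one han.ne']
    obtain ⟨m, rfl⟩ : ∃ m, n = m + 1 := ⟨n - 1, by omega⟩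
    rw [Nat.factorial_succ]
    have := Real.Gamma_nat_eq_factorial m
    push_cast at this hG hn' ⊢
    rw [this]
    field_simp
  refine ⟨Measure.isProbabilityMeasure_map hm.aemeasurable, ?_, fun n => ?_, fun n => ?_⟩
  · rw [ae_map_iff hm.aemeasurable measurableSet_Ici]
    exact hH.nonneg.mono fun ω hω => Real.rpow_nonneg (hω 1) _
  · rw [integrable_map_measure (by fun_prop) hm.aemeasurable]
    exact (key n).1
  · rw [integral_map hm.aemeasurable (by fun_prop)]
    exact (key n).2

/-- Almost surely `L ≤ x` iff `H x ≥ s`. Since `H x` is distributed as `x^{1/a} H 1`, this event has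
the probability of `s^a (H 1)^{-a} ≤ x`. -/
theorem map_sInf_eq (hH : IsStableSubordinator a H P) (ha : 0 < a) {L : Ω → ℝ≥0}
    (hLm : Measurable L) {s : ℝ≥0} (hL : ∀ᵐ ω ∂P, L ω = sInf {x : ℝ≥0 | (s : ℝ) ≤ H x ω}) :
    P.map (fun ω => (L ω : ℝ)) = P.map fun ω => (s : ℝ) ^ a * H 1 ω ^ (-a) := by
  have h1 := hH.measurable 1
  have hm : Measurable fun ω => (s : ℝ) ^ a * H 1 ω ^ (-a) := by fun_prop
  have hLm' : Measurable fun ω => (L ω : ℝ) := by fun_prop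
  rcases eq_or_ne s 0 with rfl | hs
  · refine Measure.map_congr ?_
    filter_upwards [hL, hH.nonneg] with ω hω h0
    have : {x : ℝ≥0 | ((0 : ℝ≥0) : ℝ) ≤ H x ω} = Set.univ := Set.eq_univ_of_forall fun x => by
      simpa using h0 x
    rw [hω, this, csInf_univ, bot_eq_zero]
    simp [Real.zero_rpow ha.ne']
  have hs' : (0 : ℝ) < s := by positivity
  refine Measure.ext_of_Iic _ _ fun x => ?_
  rw [Measure.map_apply hLm' measurableSet_Iic, Measure.map_apply hm measurableSet_Iic]
  rcases lt_or_ge x 0 with hx | hx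
  · rw [measure_eq_zero_iff_ae_notMem.2, measure_eq_zero_iff_ae_notMem.2]
    · refine hH.nonneg.mono fun ω hω hmem => ?_
      have : (0 : ℝ) ≤ (s : ℝ) ^ a * H 1 ω ^ (-a) :=
        mul_nonneg (by positivity) (Real.rpow_nonneg (hω 1) _)
      exact absurd (this.trans hmem) (not_le.2 hx)
    · exact ae_of_all _ fun ω hmem => absurd ((L ω).2.trans hmem) (not_le.2 hx)
  lift x to ℝ≥0 using hx
  have hLx : P ((fun ω => (L ω : ℝ)) ⁻¹' Set.Iic (x : ℝ)) = P (H x ⁻¹' Set.Ici (s : ℝ)) := by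
    refine measure_congr ?_
    filter_upwards [hL, hH.mono, hH.levy.right_cont, hH.ae_exists_le s] with ω hω hmono hrc hex
    refine propext ?_
    change (L ω : ℝ) ≤ (x : ℝ) ↔ (s : ℝ) ≤ H x ω
    rw [NNReal.coe_le_coe, hω]
    refine ⟨fun hle => ?_, fun hle => csInf_le (OrderBot.bddBelow _) hle⟩
    -- The infimum may equal `x` without being known to be attained; right-continuity carries the
    -- bound from `y > x` down to `x`.
    have hgt : ∀ y, x < y → (s : ℝ) ≤ H y ω := by
      intro y hy
      obtain ⟨w, hw, hwy⟩ := exists_lt_of_csInf_lt hex (lt_of_le_of_lt hle hy)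
      exact le_trans hw (hmono hwy.le)
    have ht := (hrc x).mono (Set.Ioi_subset_Ici_self)
    refine ge_of_tendsto ht.tendsto ?_
    filter_upwards [self_mem_nhdsWithin] with y hy using hgt y hy
  rw [hLx, ← Measure.map_apply (hH.measurable x) measurableSet_Ici, hH.map_eq_map_rpow_mul ha,
    Measure.map_apply (by fun_prop) measurableSet_Ici]
  refine measure_congr ((hH.ae_pos ha).mono fun ω hω => propext ?_)
  change (s : ℝ) ≤ (x : ℝ) ^ a⁻¹ * H 1 ω ↔ (s : ℝ) ^ a * H 1 ω ^ (-a) ≤ x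
  rw [← div_le_iff₀ hω, Real.le_rpow_inv_iff_of_pos (by positivity) x.coe_nonneg ha,
    Real.div_rpow hs'.le hω.le, Real.rpow_neg hω.le, div_eq_mul_inv]

end IsStableSubordinator

theorem IsInverseStableSubordinator.exists_law {Ω : Type*} [MeasurableSpace Ω] {P : Measure Ω}
    [IsProbabilityMeasure P] {a : ℝ} {L : ℝ≥0 → Ω → ℝ≥0}
    (hL : IsInverseStableSubordinator a L P) (ha : 0 < a) :
    ∃ μ : Measure ℝ, IsMittagLefflerLaw a μ ∧
      ∀ s, P.map (fun ω => (L s ω : ℝ)) = μ.map fun x => (s : ℝ) ^ a * x := by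
  obtain ⟨hm, hL⟩ := hL
  split_ifs at hL with h1
  · subst h1
    refine ⟨Measure.dirac 1, isMittagLefflerLaw_dirac_one, fun s => ?_⟩
    rw [Measure.map_dirac' (by fun_prop),
      Measure.map_congr (g := fun _ => (s : ℝ)) ((hL s).mono fun ω hω => by rw [hω])]
    simp
  · obtain ⟨H, hH, hLH⟩ := hL
    have hH1 := hH.measurable 1
    refine ⟨_, hH.isMittagLefflerLaw ha, fun s => ?_⟩
    rw [hH.map_sInf_eq ha (hm s) (hLH s), Measure.map_map (by fun_prop) (by fun_prop)]
    rfl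

/-! ### The probability generating function of a generalized Poisson random field -/

/-- The exponent `∑ j, l_j (z^j - 1)` of the generating function. -/
def gprfExponent {k : ℕ} (l : Fin k → ℝ) (z : ℂ) : ℂ :=
  ∑ j : Fin k, (l j : ℂ) * (z ^ ((j : ℕ) + 1) - 1)

/-- This sign bounds all the exponentials below by `1` and so provides every domination. -/
theorem gprfExponent_re_nonpos {k : ℕ} {l : Fin k → ℝ} (hl : ∀ j, 0 < l j) {z : ℂ} (hz : ‖z‖ ≤ 1) :
    (gprfExponent l z).re ≤ 0 := by
  rw [gprfExponent, Complex.re_sum]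
  refine Finset.sum_nonpos fun j _ => ?_
  rw [Complex.re_ofReal_mul, Complex.sub_re, Complex.one_re]
  have h1 : (z ^ ((j : ℕ) + 1)).re ≤ 1 := (Complex.re_le_norm _).trans (by
    rw [norm_pow]; exact pow_le_one₀ (norm_nonneg _) hz)
  exact mul_nonpos_of_nonneg_of_nonpos (hl j).le (by linarith)

theorem norm_cexp_mul_ofReal_le_one {c : ℂ} (hc : c.re ≤ 0) {y : ℝ} (hy : 0 ≤ y) :
    ‖Complex.exp (c * y)‖ ≤ 1 := by
  rw [Complex.norm_exp, Complex.re_mul_ofReal, Real.exp_le_one_iff]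
  exact mul_nonpos_of_nonpos_of_nonneg hc hy

theorem integral_pow_poissonMeasure (r : ℝ≥0) (w : ℂ) :
    ∫ n, w ^ n ∂(poissonMeasure r) = Complex.exp (r * (w - 1)) := by
  rw [integral_poissonMeasure]
  have h := NormedSpace.expSeries_div_hasSum_exp (𝔸 := ℂ) (r * w)
  rw [← Complex.exp_eq_exp_ℂ] at h
  rw [mul_sub, mul_one, sub_eq_neg_add, Complex.exp_add, ← (h.mul_left _).tsum_eq]
  congr 1; ext n
  rw [Complex.real_smul]
  push_cast
  rw [mul_pow]; ring

/-- The law of `∑ j, j N_j` for independent Poisson variables `N_j` with parameters `l_j a`. -/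
def gprfLaw {k : ℕ} (l : Fin k → ℝ) (a : ℝ) : Measure ℕ :=
  (Measure.pi fun j => poissonMeasure (l j * a).toNNReal).map
    fun v : Fin k → ℕ => ∑ j : Fin k, ((j : ℕ) + 1) * v j

instance {k : ℕ} (l : Fin k → ℝ) (a : ℝ) : IsProbabilityMeasure (gprfLaw l a) :=
  Measure.isProbabilityMeasure_map (Measurable.of_discrete).aemeasurable

theorem gprfLaw_real_singleton {k : ℕ} {l : Fin k → ℝ} (hl : ∀ j, 0 ≤ l j) {a : ℝ} (ha : 0 ≤ a)
    (n : ℕ) : (gprfLaw l a).real {n} = gprfProb l a n := by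
  have hset : (fun v : Fin k → ℕ => ∑ j : Fin k, ((j : ℕ) + 1) * v j) ⁻¹' {n} =
      (gprfTheta k n : Set (Fin k → ℕ)) := by
    ext v
    simp only [Set.mem_preimage, Set.mem_singleton_iff, gprfTheta, Finset.coe_filter,
      Fintype.mem_piFinset, Finset.mem_range, Set.mem_ofPred_eq]
    refine ⟨fun h => ⟨fun j => ?_, h⟩, fun h => h.2⟩
    have h1 : ((j : ℕ) + 1) * v j ≤ ∑ i : Fin k, ((i : ℕ) + 1) * v i :=
      Finset.single_le_sum (f := fun i : Fin k => ((i : ℕ) + 1) * v i)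
        (fun _ _ => Nat.zero_le _) (Finset.mem_univ j)
    have h2 : v j ≤ ((j : ℕ) + 1) * v j := Nat.le_mul_of_pos_left _ (Nat.succ_pos _)
    omega
  rw [gprfLaw, map_measureReal_apply Measurable.of_discrete (measurableSet_singleton n), hset,
    ← sum_measureReal_singleton, gprfProb]
  refine Finset.sum_congr rfl fun v _ => ?_
  rw [measureReal_def, Measure.pi_singleton, ENNReal.toReal_prod]
  refine Finset.prod_congr rfl fun j _ => ?_
  rw [← measureReal_def, poissonMeasure_real_singleton,
    Real.coe_toNNReal _ (mul_nonneg (hl j) ha)]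
  ring

theorem integral_pow_gprfLaw {k : ℕ} {l : Fin k → ℝ} (hl : ∀ j, 0 ≤ l j) {a : ℝ} (ha : 0 ≤ a)
    (z : ℂ) : ∫ n, z ^ n ∂(gprfLaw l a) = Complex.exp (gprfExponent l z * a) := by
  rw [gprfLaw, integral_map (Measurable.of_discrete).aemeasurable
    (Measurable.of_discrete).aestronglyMeasurable]
  have h : ∀ v : Fin k → ℕ, z ^ (∑ j : Fin k, ((j : ℕ) + 1) * v j) =
      ∏ j : Fin k, (z ^ ((j : ℕ) + 1)) ^ v j := fun v => by
    rw [← Finset.prod_pow_eq_pow_sum]; simp_rw [pow_mul]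
  simp_rw [h]
  rw [integral_fintype_prod_eq_prod (fun (j : Fin k) (m : ℕ) => (z ^ ((j : ℕ) + 1)) ^ m)]
  simp_rw [integral_pow_poissonMeasure]
  rw [← Complex.exp_sum, gprfExponent, Finset.sum_mul]
  congr 1
  refine Finset.sum_congr rfl fun j _ => ?_
  rw [Real.coe_toNNReal _ (mul_nonneg (hl j) ha)]
  push_cast; ring

theorem IsGPRF.integral_pow {Ω : Type*} [MeasurableSpace Ω] {P : Measure Ω}
    [IsProbabilityMeasure P] {k : ℕ} {l : Fin k → ℝ} {M : ℝ≥0 → ℝ≥0 → Ω → ℕ}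
    (hM : IsGPRF l M P) (hl : ∀ j, 0 ≤ l j) (z : ℂ) (p : ℝ≥0 × ℝ≥0) :
    ∫ ω, z ^ M p.1 p.2 ω ∂P = Complex.exp (gprfExponent l z * ((p.1 * p.2 : ℝ) : ℂ)) := by
  obtain ⟨s, t⟩ := p
  -- The law of increments is given for nondegenerate rectangles only, so the axes are separate
  -- cases.
  rcases eq_or_ne s 0 with rfl | hs
  · rw [integral_congr_ae (g := fun _ => 1) ((hM.zero_left t).mono fun ω hω => by simp [hω])]
    simp
  rcases eq_or_ne t 0 with rfl | ht
  · rw [integral_congr_ae (g := fun _ => 1) ((hM.zero_right s).mono fun ω hω => by simp [hω])]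
    simp
  have hst : (0 : ℝ) ≤ s * t := by positivity
  have hm := hM.measurable s t
  have hmap : P.map (M s t) = gprfLaw l (s * t) := by
    have := Measure.isProbabilityMeasure_map (μ := P) hm.aemeasurable
    refine ext_iff_measureReal_singleton.2 fun n => ?_
    rw [gprfLaw_real_singleton hl hst, map_measureReal_apply hm (measurableSet_singleton n)]
    have := hM.law_incr (0, 0) (s, t) (pos_iff_ne_zero.2 hs) (pos_iff_ne_zero.2 ht) n
    simp only [NNReal.coe_zero, sub_zero] at this
    rw [← this]
    refine measureReal_congr ?_
    filter_upwards [hM.zero_left t, hM.zero_right s, hM.zero_left 0] with ω h1 h2 h3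
    refine propext ?_
    change M s t ω = n ↔ rectIncr M (0, 0) (s, t) ω = n
    simp [rectIncr, h1, h2, h3]
  rw [← integral_pow_gprfLaw hl hst, ← hmap,
    integral_map hm.aemeasurable (Measurable.of_discrete).aestronglyMeasurable]

/-! ### Evaluation of a right-continuous field at an independent random point -/

/-- The approximation of a nonnegative real from above by multiples of `1 / (n + 1)`. -/
def ceilApprox (n : ℕ) (x : ℝ≥0) : ℝ≥0 := (⌈(x : ℝ) * (n + 1)⌉₊ : ℝ≥0) / (n + 1)

theorem le_ceilApprox (n : ℕ) (x : ℝ≥0) : x ≤ ceilApprox n x := by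
  rw [ceilApprox, le_div_iff₀ (by positivity), ← NNReal.coe_le_coe]
  push_cast
  exact Nat.le_ceil _

theorem measurable_ceilApprox (n : ℕ) : Measurable (ceilApprox n) := by
  unfold ceilApprox
  refine Measurable.div_const ?_ _
  exact (measurable_from_nat (f := fun m : ℕ => (m : ℝ≥0))).comp
    (Nat.measurable_ceil.comp (by fun_prop))

theorem tendsto_ceilApprox (x : ℝ≥0) : Tendsto (fun n => ceilApprox n x) atTop (𝓝 x) := by
  rw [← NNReal.tendsto_coe]
  have h := (tendsto_nat_ceil_mul_div_atTop (R := ℝ) x.coe_nonneg).comp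
    (tendsto_atTop_add_const_right atTop (1 : ℝ) tendsto_natCast_atTop_atTop)
  refine h.congr fun n => ?_
  simp [ceilApprox]

/-- Evaluation `(path, point) ↦ path(point)` need not be measurable on the full path space, so
Fubini does not apply directly to `M` at the random point `B`. Rounding `B` up to a grid leaves
countably many points, where Fubini works; right-continuity and dominated convergence remove the
rounding. -/
theorem IsGPRF.integral_pow_comp {Ω : Type*} [MeasurableSpace Ω] {P : Measure Ω}
    [IsProbabilityMeasure P] {k : ℕ} {l : Fin k → ℝ} {M : ℝ≥0 → ℝ≥0 → Ω → ℕ}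
    (hM : IsGPRF l M P) (hl : ∀ j, 0 < l j) {z : ℂ} (hz : ‖z‖ ≤ 1) {B : Ω → ℝ≥0 × ℝ≥0}
    (hB : Measurable B) (hind : IndepFun (fun ω (p : ℝ≥0 × ℝ≥0) => M p.1 p.2 ω) B P) :
    Integrable (fun ω => z ^ M (B ω).1 (B ω).2 ω) P ∧
    ∫ ω, z ^ M (B ω).1 (B ω).2 ω ∂P =
      ∫ ω, Complex.exp (gprfExponent l z * (((B ω).1 * (B ω).2 : ℝ) : ℂ)) ∂P := by
  set A : Ω → ℝ≥0 × ℝ≥0 → ℕ := fun ω p => M p.1 p.2 ω with hA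
  have hAm : Measurable A := measurable_pi_lambda _ fun p => hM.measurable p.1 p.2
  set g : ℕ → ℝ≥0 × ℝ≥0 → ℝ≥0 × ℝ≥0 := fun n q => (ceilApprox n q.1, ceilApprox n q.2) with hg
  have hgm : ∀ n, Measurable (g n) := fun n =>
    ((measurable_ceilApprox n).comp measurable_fst).prodMk
      ((measurable_ceilApprox n).comp measurable_snd)
  have hzn : ∀ m : ℕ, ‖z ^ m‖ ≤ 1 := fun m => by
    rw [norm_pow]; exact pow_le_one₀ (norm_nonneg _) hz
  -- The rounded evaluation factors through a countable set of indices, and each single coordinate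
  -- of the path is measurable.
  have hF : ∀ n, Measurable fun x : (ℝ≥0 × ℝ≥0 → ℕ) × (ℝ≥0 × ℝ≥0) => z ^ x.1 (g n x.2) := by
    intro n
    have h1 : Measurable fun x : (ℝ≥0 × ℝ≥0 → ℕ) × (ℕ × ℕ) =>
        z ^ x.1 ((x.2.1 : ℝ≥0) / (n + 1), (x.2.2 : ℝ≥0) / (n + 1)) :=
      measurable_from_prod_countable_left fun y =>
        (measurable_from_nat (f := fun m => z ^ m)).comp
          (measurable_pi_apply ((y.1 : ℝ≥0) / (n + 1), (y.2 : ℝ≥0) / (n + 1)))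
    have h2 : Measurable fun x : (ℝ≥0 × ℝ≥0 → ℕ) × (ℝ≥0 × ℝ≥0) =>
        (x.1, ((⌈(x.2.1 : ℝ) * (n + 1)⌉₊, ⌈(x.2.2 : ℝ) * (n + 1)⌉₊) : ℕ × ℕ)) := by
      refine measurable_fst.prodMk (Measurable.prodMk ?_ ?_)
      · exact Nat.measurable_ceil.comp (by fun_prop)
      · exact Nat.measurable_ceil.comp (by fun_prop)
    exact h1.comp h2
  have hFn : ∀ n, ∫ ω, z ^ A ω (g n (B ω)) ∂P =
      ∫ ω, Complex.exp (gprfExponent l z * (((g n (B ω)).1 * (g n (B ω)).2 : ℝ) : ℂ)) ∂P := by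
    intro n
    have hmap := (indepFun_iff_map_prod_eq_prod_map_map hAm.aemeasurable hB.aemeasurable).1 hind
    have := Measure.isProbabilityMeasure_map (μ := P) hAm.aemeasurable
    have := Measure.isProbabilityMeasure_map (μ := P) hB.aemeasurable
    have h1 : ∫ ω, z ^ A ω (g n (B ω)) ∂P =
        ∫ x, z ^ x.1 (g n x.2) ∂(P.map fun ω => (A ω, B ω)) := by
      rw [integral_map (hAm.prodMk hB).aemeasurable (hF n).aestronglyMeasurable]
    rw [h1, hmap, integral_prod_symm]
    · rw [integral_map hB.aemeasurable
        (hF n).stronglyMeasurable.integral_prod_left'.aestronglyMeasurable]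
      refine integral_congr_ae (ae_of_all _ fun ω => ?_)
      dsimp only
      rw [← hM.integral_pow (fun j => (hl j).le), integral_map hAm.aemeasurable]
      exact ((hF n).comp (measurable_id.prodMk measurable_const)).aestronglyMeasurable
    · exact Integrable.of_bound (hF n).aestronglyMeasurable 1 (ae_of_all _ fun _ => hzn _)
  have htend : ∀ q, Tendsto (fun n => g n q) atTop (𝓝 q) := fun q =>
    (tendsto_ceilApprox q.1).prodMk_nhds (tendsto_ceilApprox q.2)
  have hlim : ∀ᵐ ω ∂P, Tendsto (fun n => z ^ A ω (g n (B ω))) atTop (𝓝 (z ^ A ω (B ω))) := by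
    filter_upwards [hM.right_cont] with ω hω
    have h1 : Tendsto (fun n => g n (B ω)) atTop (𝓝[Set.Ici (B ω)] (B ω)) :=
      tendsto_nhdsWithin_iff.2 ⟨htend _, Eventually.of_forall fun n =>
        ⟨le_ceilApprox n _, le_ceilApprox n _⟩⟩
    exact ((continuous_of_discreteTopology (f := fun m : ℕ => z ^ m)).tendsto _).comp
      ((hω (B ω)).tendsto.comp h1)
  have hmeas : ∀ n, AEStronglyMeasurable (fun ω => z ^ A ω (g n (B ω))) P := fun n =>
    ((hF n).comp (hAm.prodMk hB)).aestronglyMeasurable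
  refine ⟨Integrable.of_bound (aestronglyMeasurable_of_tendsto_ae atTop hmeas hlim) 1
    (ae_of_all _ fun _ => hzn _), ?_⟩
  have hL := tendsto_integral_of_dominated_convergence (fun _ => 1) hmeas (integrable_const 1)
    (fun n => ae_of_all _ fun _ => hzn _) hlim
  simp_rw [hFn] at hL
  refine tendsto_nhds_unique hL ?_
  refine tendsto_integral_of_dominated_convergence (fun _ => 1) (fun n => ?_) (integrable_const 1)
    (fun n => ae_of_all _ fun ω => ?_) (ae_of_all _ fun ω => ?_)
  · have := (hgm n).comp hB
    have h1 : Measurable fun ω => (g n (B ω)).1 := measurable_fst.comp this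
    have h2 : Measurable fun ω => (g n (B ω)).2 := measurable_snd.comp this
    fun_prop
  · exact norm_cexp_mul_ofReal_le_one (gprfExponent_re_nonpos hl hz) (by positivity)
  · have hc : Continuous fun q : ℝ≥0 × ℝ≥0 =>
        Complex.exp (gprfExponent l z * ((q.1 * q.2 : ℝ) : ℂ)) := by fun_prop
    exact (hc.tendsto _).comp (htend _)

theorem IsFGPRF.exists_laws {Ω : Type*} [MeasurableSpace Ω] {P : Measure Ω}
    [IsProbabilityMeasure P] {k : ℕ} {l : Fin k → ℝ} {a b : ℝ} {X : ℝ≥0 → ℝ≥0 → Ω → ℕ}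
    (hX : IsFGPRF a b l X P) (hl : ∀ j, 0 < l j) (ha : 0 < a) (hb : 0 < b) :
    ∃ μ ν : Measure ℝ, IsMittagLefflerLaw a μ ∧ IsMittagLefflerLaw b ν ∧
      ∀ z : ℂ, ‖z‖ ≤ 1 → ∀ s t : ℝ≥0, Integrable (fun ω => z ^ X s t ω) P ∧
        ∫ ω, z ^ X s t ω ∂P = ∫ p, Complex.exp (gprfExponent l z * (s ^ a : ℝ) * (t ^ b : ℝ) *
          ((p.1 * p.2 : ℝ) : ℂ)) ∂(μ.prod ν) := by
  obtain ⟨M, L₁, L₂, hM, hL₁, hL₂, hL, hML, hX⟩ := hX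
  obtain ⟨μ, hμ, hμL⟩ := hL₁.exists_law ha
  obtain ⟨ν, hν, hνL⟩ := hL₂.exists_law hb
  refine ⟨μ, ν, hμ, hν, fun z hz s t => ?_⟩
  have := hμ.isProbabilityMeasure
  have := hν.isProbabilityMeasure
  have hm₁ := hL₁.1 s
  have hm₂ := hL₂.1 t
  have hind : IndepFun (fun ω (p : ℝ≥0 × ℝ≥0) => M p.1 p.2 ω) (fun ω => (L₁ s ω, L₂ t ω)) P :=
    hML.comp (φ := id) (ψ := fun x : (ℝ≥0 → ℝ≥0) × (ℝ≥0 → ℝ≥0) => (x.1 s, x.2 t)) measurable_id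
      (by fun_prop)
  have hind' : IndepFun (fun ω => (L₁ s ω : ℝ)) (fun ω => (L₂ t ω : ℝ)) P :=
    hL.comp (φ := fun x : ℝ≥0 → ℝ≥0 => (x s : ℝ)) (ψ := fun x : ℝ≥0 → ℝ≥0 => (x t : ℝ))
      (by fun_prop) (by fun_prop)
  simp_rw [hX]
  have key := hM.integral_pow_comp hl hz (hm₁.prodMk hm₂) hind
  refine ⟨key.1, key.2.trans ?_⟩
  have hmap := (indepFun_iff_map_prod_eq_prod_map_map (by fun_prop) (by fun_prop)).1 hind'
  rw [hμL, hνL, Measure.map_prod_map _ _ (by fun_prop) (by fun_prop)] at hmap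
  have h1 : ∫ ω, Complex.exp (gprfExponent l z * ((L₁ s ω * L₂ t ω : ℝ) : ℂ)) ∂P =
      ∫ p : ℝ × ℝ, Complex.exp (gprfExponent l z * ((p.1 * p.2 : ℝ) : ℂ))
        ∂(P.map fun ω => ((L₁ s ω : ℝ), (L₂ t ω : ℝ))) := by
    rw [integral_map (by fun_prop) (by fun_prop)]
  rw [h1, hmap, integral_map (by fun_prop) (by fun_prop)]
  refine integral_congr_ae (ae_of_all _ fun p => ?_)
  simp only [Prod.map]
  push_cast
  ring_nf

/-! ### The Wright series -/

theorem genWrightTerm_one_one (a b : ℝ) (x : ℂ) (n : ℕ) :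
    genWrightTerm ![(1, 1), (1, 1)] ![(1, a), (1, b)] x n =
      ((n.factorial / (Real.Gamma (a * n + 1) * Real.Gamma (b * n + 1)) : ℝ) : ℂ) * x ^ n := by
  have h1 : Real.Gamma (1 * (n : ℝ) + 1) = n.factorial := by
    rw [one_mul, Real.Gamma_nat_eq_factorial]
  have h2 : (n.factorial : ℝ) ≠ 0 := by positivity
  rw [genWrightTerm]
  congr 2
  simp only [Fin.prod_univ_two, Matrix.cons_val_zero, Matrix.cons_val_one, h1]
  rw [mul_div_mul_right _ _ h2]

theorem hasSum_conditional_nat_iff {f : ℕ → ℂ} {S : ℂ} :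
    HasSum f S (SummationFilter.conditional ℕ) ↔
      Tendsto (fun n => ∑ i ∈ Finset.range n, f i) atTop (𝓝 S) := by
  rw [HasSum, SummationFilter.conditional_filter_eq_map_range, tendsto_map'_iff]
  rfl

/-- The Stirling sequence decreases from its value `e / √2` at `1`; `√n` is then bounded crudely by
`n`. -/
theorem factorial_le_exp_mul_self_mul_pow {n : ℕ} (hn : n ≠ 0) :
    (n.factorial : ℝ) ≤ Real.exp 1 * n * (n * Real.exp (-1)) ^ n := by
  obtain ⟨m, rfl⟩ : ∃ m, n = m + 1 := ⟨n - 1, by omega⟩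
  have h := Stirling.stirlingSeq'_antitone (Nat.zero_le m)
  simp only [Function.comp_apply, Nat.succ_eq_add_one, zero_add, Stirling.stirlingSeq_one] at h
  rw [Stirling.stirlingSeq, div_le_iff₀ (by positivity)] at h
  refine h.trans ?_
  have h1 : (1 : ℝ) ≤ ((m + 1 : ℕ) : ℝ) := by push_cast; linarith [Nat.cast_nonneg (α := ℝ) m]
  have hs : √((m + 1 : ℕ) : ℝ) ≤ ((m + 1 : ℕ) : ℝ) := by
    rw [Real.sqrt_le_left (by positivity)]
    nlinarith
  rw [Real.sqrt_mul (by norm_num), Real.exp_neg, ← div_eq_mul_inv]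
  calc Real.exp 1 / √2 * (√2 * √((m + 1 : ℕ) : ℝ) * (((m + 1 : ℕ) : ℝ) / Real.exp 1) ^ (m + 1))
      = Real.exp 1 * √((m + 1 : ℕ) : ℝ) * (((m + 1 : ℕ) : ℝ) / Real.exp 1) ^ (m + 1) := by
        field_simp
    _ ≤ _ := by gcongr

theorem rpow_pow_le_Gamma {a : ℝ} (ha : 0 < a) (n : ℕ) :
    (a ^ a * (n * Real.exp (-1)) ^ a) ^ n ≤ Real.Gamma (a * n + 1) := by
  have hn : (0 : ℝ) ≤ a * n := by positivity
  refine le_of_eq_of_le ?_ (exp_neg_mul_rpow_le_Gamma hn hn)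
  rw [← Real.mul_rpow ha.le (by positivity), ← Real.rpow_natCast, ← Real.rpow_mul (by positivity),
    ← mul_assoc, Real.mul_rpow hn (Real.exp_pos _).le, ← Real.exp_mul, mul_comm]
  ring_nf

/-- The bound has the form `e n q_n^n`: `q_n` tends to `0` if `a + b > 1` and is the constant `‖x‖ /
(a^a b^b)` if `a + b = 1`, whence the two convergence criteria. -/
theorem norm_genWrightTerm_le {a b : ℝ} (ha : 0 < a) (hb : 0 < b) (x : ℂ) {n : ℕ} (hn : n ≠ 0) :
    ‖genWrightTerm ![(1, 1), (1, 1)] ![(1, a), (1, b)] x n‖ ≤ Real.exp 1 * (n *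
      (‖x‖ / (a ^ a * b ^ b) * (n * Real.exp (-1)) ^ (-(a + b - 1))) ^ n) := by
  have hn' : (0 : ℝ) < n := by positivity
  have hu0 : 0 < n * Real.exp (-1) := by positivity
  have hA := rpow_pow_le_Gamma ha n
  have hB := rpow_pow_le_Gamma hb n
  have hF := factorial_le_exp_mul_self_mul_pow hn
  have hGa := Real.Gamma_pos_of_pos (show 0 < a * n + 1 by positivity)
  have hGb := Real.Gamma_pos_of_pos (show 0 < b * n + 1 by positivity)
  rw [genWrightTerm_one_one, norm_mul, norm_pow, Complex.norm_real, Real.norm_eq_abs,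
    abs_of_nonneg (by positivity)]
  generalize n * Real.exp (-1) = u at *
  have hqn : ‖x‖ / (a ^ a * b ^ b) * u ^ (-(a + b - 1)) =
      ‖x‖ * u / ((a ^ a * u ^ a) * (b ^ b * u ^ b)) := by
    rw [neg_sub, Real.rpow_sub hu0, Real.rpow_one, Real.rpow_add hu0]
    have h1 : 0 < a ^ a := by positivity
    have h2 : 0 < b ^ b := by positivity
    have h3 : 0 < u ^ a := by positivity
    have h4 : 0 < u ^ b := by positivity
    generalize a ^ a = A at *
    generalize b ^ b = B at *
    generalize u ^ a = U at *
    generalize u ^ b = V at *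
    field_simp
  have hpa : 0 < a ^ a * u ^ a := by positivity
  have hpb : 0 < b ^ b * u ^ b := by positivity
  rw [hqn, div_pow, mul_pow, mul_pow (a ^ a * u ^ a)]
  generalize a ^ a * u ^ a = A at *
  generalize b ^ b * u ^ b = B at *
  calc n.factorial / (Real.Gamma (a * n + 1) * Real.Gamma (b * n + 1)) * ‖x‖ ^ n
      ≤ (Real.exp 1 * n * u ^ n) / (A ^ n * B ^ n) * ‖x‖ ^ n := by
        have := mul_le_mul hA hB (by positivity) hGa.le
        gcongr
    _ = Real.exp 1 * (n * (‖x‖ ^ n * u ^ n / (A ^ n * B ^ n))) := by ring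

theorem summable_genWrightTerm {a b : ℝ} (ha : 0 < a) (hb : 0 < b) {x : ℂ}
    (h : 1 < a + b ∨ (a + b = 1 ∧ ‖x‖ < a ^ a * b ^ b)) :
    Summable (genWrightTerm ![(1, 1), (1, 1)] ![(1, a), (1, b)] x) := by
  have hab : 0 < a ^ a * b ^ b := by positivity
  obtain ⟨ρ, hρ0, hρ1, hρ⟩ : ∃ ρ : ℝ, 0 ≤ ρ ∧ ρ < 1 ∧ ∀ᶠ n : ℕ in atTop,
      ‖x‖ / (a ^ a * b ^ b) * (n * Real.exp (-1)) ^ (-(a + b - 1)) ≤ ρ := by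
    rcases h with h | ⟨h, hx⟩
    · refine ⟨1 / 2, by norm_num, by norm_num, ?_⟩
      have h1 : Tendsto (fun n : ℕ => (n : ℝ) * Real.exp (-1)) atTop atTop :=
        tendsto_natCast_atTop_atTop.atTop_mul_const (Real.exp_pos _)
      have h2 := ((tendsto_rpow_neg_atTop (y := a + b - 1) (by linarith)).comp h1).const_mul
        (‖x‖ / (a ^ a * b ^ b))
      rw [mul_zero] at h2
      exact (h2.eventually (gt_mem_nhds (by norm_num : (0 : ℝ) < 1 / 2))).mono fun n hn => hn.le
    · refine ⟨‖x‖ / (a ^ a * b ^ b), by positivity, (div_lt_one hab).2 hx, ?_⟩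
      filter_upwards with n
      simp [h]
  have hsum : Summable fun n : ℕ => Real.exp 1 * ((n : ℝ) ^ 1 * ρ ^ n) := by
    have h1 : ‖ρ‖ < 1 := by rwa [Real.norm_eq_abs, abs_of_nonneg hρ0]
    have h2 := summable_pow_mul_geometric_of_norm_lt_one 1 h1
    exact h2.mul_left _
  refine Summable.of_norm_bounded_eventually_nat hsum ?_
  filter_upwards [hρ, eventually_ne_atTop 0] with n hn hn0
  refine (norm_genWrightTerm_le ha hb x hn0).trans ?_
  rw [pow_one]
  gcongr

section ProductLaw

variable {a b : ℝ} {μ ν : Measure ℝ}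

theorem IsMittagLefflerLaw.ae_prod_nonneg (hμ : IsMittagLefflerLaw a μ)
    (hν : IsMittagLefflerLaw b ν) : ∀ᵐ p ∂(μ.prod ν), 0 ≤ p.1 ∧ 0 ≤ p.2 := by
  have := hμ.isProbabilityMeasure
  have := hν.isProbabilityMeasure
  exact (Measure.quasiMeasurePreserving_fst.ae hμ.nonneg).and
    (Measure.quasiMeasurePreserving_snd.ae hν.nonneg)

theorem IsMittagLefflerLaw.integrable_prod_pow (hμ : IsMittagLefflerLaw a μ)
    (hν : IsMittagLefflerLaw b ν) (n : ℕ) :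
    Integrable (fun p : ℝ × ℝ => (p.1 * p.2) ^ n) (μ.prod ν) := by
  simp_rw [mul_pow]
  exact (hμ.integrable_pow n).mul_prod (hν.integrable_pow n)

theorem IsMittagLefflerLaw.integral_prod_pow (hμ : IsMittagLefflerLaw a μ)
    (hν : IsMittagLefflerLaw b ν) (n : ℕ) :
    ∫ p, (p.1 * p.2) ^ n ∂(μ.prod ν) =
      n.factorial * (n.factorial / (Real.Gamma (a * n + 1) * Real.Gamma (b * n + 1))) := by
  have := hμ.isProbabilityMeasure
  have := hν.isProbabilityMeasure
  simp_rw [mul_pow]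
  rw [integral_prod_mul (fun x : ℝ => x ^ n) fun x : ℝ => x ^ n, hμ.moment, hν.moment]
  field_simp

/-- The `n`-th moment of the product is `n!²` over the two Gamma factors, so `x^n / n!` times it is
the `n`-th Wright term. -/
theorem IsMittagLefflerLaw.hasSum_genWrightTerm (hμ : IsMittagLefflerLaw a μ)
    (hν : IsMittagLefflerLaw b ν) {x : ℂ}
    (hs : Summable fun n => ‖genWrightTerm ![(1, 1), (1, 1)] ![(1, a), (1, b)] x n‖)
    (ha : 0 < a) (hb : 0 < b) :
    HasSum (genWrightTerm ![(1, 1), (1, 1)] ![(1, a), (1, b)] x)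
      (∫ p, Complex.exp (x * ((p.1 * p.2 : ℝ) : ℂ)) ∂(μ.prod ν)) := by
  have h0 : ∀ᵐ p ∂(μ.prod ν), 0 ≤ p.1 * p.2 :=
    (hμ.ae_prod_nonneg hν).mono fun p hp => mul_nonneg hp.1 hp.2
  refine (hasSum_moments_integral_cexp h0 (hμ.integrable_prod_pow hν) (w := x) ?_).congr_fun
    fun n => ?_
  · refine hs.congr fun n => ?_
    have h1 : (n.factorial : ℝ) ≠ 0 := by positivity
    have hGa := Real.Gamma_pos_of_pos (show 0 < a * n + 1 by positivity)
    have hGb := Real.Gamma_pos_of_pos (show 0 < b * n + 1 by positivity)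
    rw [genWrightTerm_one_one, norm_mul, norm_pow, Complex.norm_real, Real.norm_eq_abs,
      abs_of_nonneg (by positivity), hμ.integral_prod_pow hν]
    field_simp
  · have h1 : (n.factorial : ℂ) ≠ 0 := by exact_mod_cast n.factorial_ne_zero
    rw [genWrightTerm_one_one, hμ.integral_prod_pow hν]
    push_cast
    field_simp

/-- Convergence at `x` may be only conditional, which forbids termwise integration there. It does
bound the terms, so at `ρ x` with `0 < ρ < 1` convergence is absolute. As `ρ → 1`, Abel's theorem
handles the series, and dominated convergence, by `Re x ≤ 0`, the integral. -/
theorem IsMittagLefflerLaw.integral_cexp_eq_genWright (hμ : IsMittagLefflerLaw a μ)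
    (hν : IsMittagLefflerLaw b ν) (ha : 0 < a) (hb : 0 < b) {x : ℂ} (hx : x.re ≤ 0)
    (hconv : GenWrightConverges ![(1, 1), (1, 1)] ![(1, a), (1, b)] x) :
    ∫ p, Complex.exp (x * ((p.1 * p.2 : ℝ) : ℂ)) ∂(μ.prod ν) =
      genWright ![(1, 1), (1, 1)] ![(1, a), (1, b)] x := by
  have := hμ.isProbabilityMeasure
  have := hν.isProbabilityMeasure
  set f := genWrightTerm ![(1, 1), (1, 1)] ![(1, a), (1, b)] x with hf
  have hS : Tendsto (fun n => ∑ i ∈ Finset.range n, f i) atTop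
      (𝓝 (genWright ![(1, 1), (1, 1)] ![(1, a), (1, b)] x)) :=
    hasSum_conditional_nat_iff.1 hconv.hasSum
  have hbd : ∃ C, ∀ n, ‖f n‖ ≤ C := by
    obtain ⟨C, hC⟩ := (Metric.isBounded_range_of_tendsto _ hS).exists_norm_le
    refine ⟨C + C, fun n => ?_⟩
    have h1 : f n = ∑ i ∈ Finset.range (n + 1), f i - ∑ i ∈ Finset.range n, f i := by
      rw [Finset.sum_range_succ]; ring
    rw [h1]
    exact (norm_sub_le _ _).trans (add_le_add (hC _ ⟨n + 1, rfl⟩) (hC _ ⟨n, rfl⟩))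
  obtain ⟨C, hC⟩ := hbd
  have hterm : ∀ (ρ : ℝ) (n : ℕ), genWrightTerm ![(1, 1), (1, 1)] ![(1, a), (1, b)] (ρ * x) n =
      f n * (ρ : ℂ) ^ n := by
    intro ρ n
    rw [hf, genWrightTerm_one_one, genWrightTerm_one_one, mul_pow]; ring
  have hin : ∀ᶠ ρ in 𝓝[<] (1 : ℝ), 0 < ρ ∧ ρ < 1 := by
    filter_upwards [Ioo_mem_nhdsLT (zero_lt_one' ℝ)] with ρ hρ using hρ
  have habel := Complex.tendsto_tsum_powerSeries_nhdsWithin_lt hS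
  rw [tendsto_map'_iff] at habel
  have h1 : Tendsto (fun ρ : ℝ => ∫ p : ℝ × ℝ, Complex.exp ((ρ * x) * ((p.1 * p.2 : ℝ) : ℂ))
      ∂(μ.prod ν)) (𝓝[<] 1) (𝓝 (genWright ![(1, 1), (1, 1)] ![(1, a), (1, b)] x)) := by
    refine habel.congr' (hin.mono fun ρ hρ => ?_)
    have hs : Summable fun n =>
        ‖genWrightTerm ![(1, 1), (1, 1)] ![(1, a), (1, b)] (ρ * x) n‖ := by
      refine Summable.of_nonneg_of_le (fun _ => norm_nonneg _) (fun n => ?_)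
        ((summable_geometric_of_lt_one hρ.1.le hρ.2).mul_left C)
      rw [hterm, norm_mul, norm_pow, Complex.norm_real, Real.norm_eq_abs, abs_of_pos hρ.1]
      have := hρ.1.le
      gcongr
      exact hC n
    dsimp only
    rw [← (hμ.hasSum_genWrightTerm hν hs ha hb).tsum_eq]
    simp_rw [hterm]
    rfl
  refine tendsto_nhds_unique ?_ h1
  refine tendsto_integral_filter_of_dominated_convergence (fun _ => 1) ?_ ?_ (integrable_const 1) ?_
  · exact Eventually.of_forall fun ρ => by fun_prop
  · refine hin.mono fun ρ hρ => (hμ.ae_prod_nonneg hν).mono fun p hp => ?_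
    refine norm_cexp_mul_ofReal_le_one ?_ (mul_nonneg hp.1 hp.2)
    rw [Complex.re_ofReal_mul]
    exact mul_nonpos_of_nonneg_of_nonpos hρ.1.le hx
  · refine ae_of_all _ fun p => ?_
    have hc : Continuous fun ρ : ℝ => Complex.exp ((ρ * x) * ((p.1 * p.2 : ℝ) : ℂ)) := by fun_prop
    have := (hc.tendsto 1).mono_left (nhdsWithin_le_nhds (s := Set.Iio 1))
    simpa using this

end ProductLaw

/-! ### Integrals with respect to the beta distribution -/

section BetaMeasure

variable {a b : ℝ}

theorem betaPDFReal_nonneg (ha : 0 < a) (hb : 0 < b) (u : ℝ) : 0 ≤ betaPDFReal a b u := by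
  by_cases h : 0 < u ∧ u < 1
  · exact (betaPDFReal_pos h.1 h.2 ha hb).le
  · rw [betaPDFReal, if_neg h]

theorem measurable_betaPDF : Measurable (betaPDF a b) :=
  (measurable_betaPDFReal a b).ennreal_ofReal

theorem toReal_betaPDF (ha : 0 < a) (hb : 0 < b) (u : ℝ) :
    (betaPDF a b u).toReal = betaPDFReal a b u :=
  ENNReal.toReal_ofReal (betaPDFReal_nonneg ha hb u)

theorem integrable_betaMeasure_iff {E : Type*} [NormedAddCommGroup E] [NormedSpace ℝ E]
    (ha : 0 < a) (hb : 0 < b) {h : ℝ → E} :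
    Integrable h (betaMeasure a b) ↔ Integrable fun u => betaPDFReal a b u • h u := by
  rw [betaMeasure, integrable_withDensity_iff_integrable_smul' measurable_betaPDF
    (ae_of_all _ fun u => ENNReal.ofReal_lt_top)]
  simp_rw [toReal_betaPDF ha hb]

theorem integral_betaMeasure {E : Type*} [NormedAddCommGroup E] [NormedSpace ℝ E]
    (ha : 0 < a) (hb : 0 < b) (h : ℝ → E) :
    ∫ u, h u ∂(betaMeasure a b) = ∫ u, betaPDFReal a b u • h u := by
  rw [betaMeasure, integral_withDensity_eq_integral_toReal_smul measurable_betaPDF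
    (ae_of_all _ fun u => ENNReal.ofReal_lt_top)]
  simp_rw [toReal_betaPDF ha hb]

theorem ae_mem_Ioo_betaMeasure : ∀ᵐ u ∂(betaMeasure a b), u ∈ Set.Ioo (0 : ℝ) 1 := by
  rw [betaMeasure, ae_withDensity_iff measurable_betaPDF]
  refine ae_of_all _ fun u hu => ?_
  by_contra h
  refine hu ?_
  rw [betaPDF, betaPDFReal, if_neg (by exact h), ENNReal.ofReal_zero]

/-- Multiplying the density by `u^q` gives a multiple of the Beta(`a + q`, `b`) density. -/
theorem integral_rpow_betaMeasure (ha : 0 < a) (hb : 0 < b) {q : ℝ} (hq : 0 ≤ q) :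
    ∫ u, u ^ q ∂(betaMeasure a b) = beta (a + q) b / beta a b := by
  have haq : 0 < a + q := by linarith
  have hB := beta_pos ha hb
  have hBq := beta_pos haq hb
  have h1 : ∀ u, betaPDFReal a b u • u ^ q =
      beta (a + q) b / beta a b * betaPDFReal (a + q) b u := by
    intro u
    unfold betaPDFReal
    split_ifs with hu
    · rw [show a + q - 1 = (a - 1) + q by ring, Real.rpow_add hu.1, smul_eq_mul]
      field_simp
    · simp
  have h2 : ∫ u, betaPDFReal (a + q) b u = 1 := by
    rw [integral_eq_lintegral_of_nonneg_ae (ae_of_all _ (betaPDFReal_nonneg haq hb))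
      (measurable_betaPDFReal _ _).aestronglyMeasurable]
    have := lintegral_betaPDF_eq_one haq hb
    simp only [betaPDF] at this
    rw [this, ENNReal.toReal_one]
  rw [integral_betaMeasure ha hb]
  simp_rw [h1]
  rw [integral_const_mul, h2, mul_one]

end BetaMeasure

/-! ### The Abel-type integral equation of the Mittag-Leffler law -/

namespace IsMittagLefflerLaw

variable {a : ℝ} {μ : Measure ℝ}

theorem ae_beta_prod (hμ : IsMittagLefflerLaw a μ) (ha : 0 < a) (ha1 : a < 1) :
    ∀ᵐ p ∂((betaMeasure a (1 - a)).prod μ), p.1 ∈ Set.Ioo (0 : ℝ) 1 ∧ 0 ≤ p.2 := by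
  have := hμ.isProbabilityMeasure
  have := isProbabilityMeasureBeta ha (sub_pos.2 ha1)
  exact (Measure.quasiMeasurePreserving_fst.ae ae_mem_Ioo_betaMeasure).and
    (Measure.quasiMeasurePreserving_snd.ae hμ.nonneg)

/-- By independence the integral is `Γ(a+1) E[U^{an}] E[A^{n+1}]`; the Gamma factors cancel down to
the `n`-th moment of `A` itself. -/
theorem beta_moment (hμ : IsMittagLefflerLaw a μ) (ha : 0 < a) (ha1 : a < 1) (n : ℕ) :
    Integrable (fun p : ℝ × ℝ => Real.Gamma (a + 1) * p.2 * (p.1 ^ a * p.2) ^ n)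
      ((betaMeasure a (1 - a)).prod μ) ∧
    ∫ p, Real.Gamma (a + 1) * p.2 * (p.1 ^ a * p.2) ^ n ∂((betaMeasure a (1 - a)).prod μ) =
      n.factorial / Real.Gamma (a * n + 1) := by
  have := hμ.isProbabilityMeasure
  have h1a : 0 < 1 - a := sub_pos.2 ha1
  have := isProbabilityMeasureBeta ha h1a
  have hcongr : ∀ᵐ p ∂((betaMeasure a (1 - a)).prod μ),
      p.1 ^ (a * n) * (Real.Gamma (a + 1) * p.2 ^ (n + 1)) =
        Real.Gamma (a + 1) * p.2 * (p.1 ^ a * p.2) ^ n := by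
    filter_upwards [hμ.ae_beta_prod ha ha1] with p hp
    rw [Real.rpow_mul hp.1.1.le, Real.rpow_natCast]; ring
  have hq : 0 ≤ a * n := by positivity
  have hi1 : Integrable (fun u : ℝ => u ^ (a * n)) (betaMeasure a (1 - a)) := by
    refine Integrable.of_bound ((measurable_id.pow_const _).aestronglyMeasurable) 1
      (ae_mem_Ioo_betaMeasure.mono fun u hu => ?_)
    rw [Real.norm_eq_abs, abs_of_nonneg (Real.rpow_nonneg hu.1.le _)]
    exact Real.rpow_le_one hu.1.le hu.2.le hq
  have hi2 := (hμ.integrable_pow (n + 1)).const_mul (Real.Gamma (a + 1))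
  refine ⟨(hi1.mul_prod hi2).congr hcongr, ?_⟩
  rw [← integral_congr_ae hcongr, integral_prod_mul (fun u : ℝ => u ^ (a * n))
    fun x : ℝ => Real.Gamma (a + 1) * x ^ (n + 1), integral_rpow_betaMeasure ha h1a hq,
    integral_const_mul, hμ.moment]
  have e1 : a + a * n + (1 - a) = a * n + 1 := by ring
  have e2 : a * ((n + 1 : ℕ) : ℝ) + 1 = (a + a * n) + 1 := by push_cast; ring
  have han : 0 < a + a * n := by positivity
  simp only [beta]
  rw [e1, e2, Real.Gamma_add_one han.ne', Real.Gamma_add_one ha.ne', add_sub_cancel, Real.Gamma_one,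
    Nat.factorial_succ]
  have g1 := (Real.Gamma_pos_of_pos han).ne'
  have g2 := (Real.Gamma_pos_of_pos ha).ne'
  have g3 := (Real.Gamma_pos_of_pos h1a).ne'
  have g4 := (Real.Gamma_pos_of_pos (show 0 < a * n + 1 by positivity)).ne'
  have g5 : (n : ℝ) + 1 ≠ 0 := by positivity
  rw [show a + a * (n : ℝ) = a * (n + 1) by ring] at *
  push_cast
  field_simp

/-- If `A` has the Mittag-Leffler law and `U` is an independent beta variable with parameters
`a`, `1 - a`, then `E [Γ(a + 1) A g(U ^ a A)] = E g(A)`. -/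
theorem integral_beta_prod (hμ : IsMittagLefflerLaw a μ) (ha : 0 < a) (ha1 : a < 1) {g : ℝ → ℂ}
    (hg : Measurable g) :
    ∫ p, ((Real.Gamma (a + 1) * p.2 : ℝ) : ℂ) * g (p.1 ^ a * p.2)
      ∂((betaMeasure a (1 - a)).prod μ) = ∫ y, g y ∂μ := by
  have := hμ.isProbabilityMeasure
  have h1a : 0 < 1 - a := sub_pos.2 ha1
  have := isProbabilityMeasureBeta ha h1a
  have hG := Real.Gamma_pos_of_pos (show 0 < a + 1 by linarith)
  set τ := (betaMeasure a (1 - a)).prod μ with hτ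
  set d : ℝ × ℝ → ENNReal := fun p => ENNReal.ofReal (Real.Gamma (a + 1) * p.2) with hd
  have hdm : Measurable d := by fun_prop
  have hdlt : ∀ᵐ p ∂τ, d p < ⊤ := ae_of_all _ fun p => ENNReal.ofReal_lt_top
  have hdr : ∀ᵐ p ∂τ, (d p).toReal = Real.Gamma (a + 1) * p.2 :=
    (hμ.ae_beta_prod ha ha1).mono fun p hp =>
      ENNReal.toReal_ofReal (mul_nonneg hG.le hp.2)
  have hφ : Measurable fun p : ℝ × ℝ => p.1 ^ a * p.2 :=
    (measurable_fst.pow_const a).mul measurable_snd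
  -- The law of `U^a A` under the density `Γ(a+1) A`. By `beta_moment` it has the moments of `μ`,
  -- hence equals `μ`, and the identity extends from powers to all measurable `g`.
  set ν := (τ.withDensity d).map fun p => p.1 ^ a * p.2 with hν
  have hint : ∀ n : ℕ, Integrable (fun y : ℝ => y ^ n) ν := by
    intro n
    rw [hν, integrable_map_measure (by fun_prop) hφ.aemeasurable,
      integrable_withDensity_iff_integrable_smul' hdm hdlt]
    refine (hμ.beta_moment ha ha1 n).1.congr (hdr.mono fun p hp => ?_)
    simp only [Function.comp_apply, smul_eq_mul]
    rw [hp]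
  have hmom : ∀ n : ℕ, ∫ y, y ^ n ∂ν = n.factorial / Real.Gamma (a * n + 1) := by
    intro n
    rw [hν, integral_map hφ.aemeasurable (by fun_prop),
      integral_withDensity_eq_integral_toReal_smul hdm hdlt, ← (hμ.beta_moment ha ha1 n).2]
    refine integral_congr_ae (hdr.mono fun p hp => ?_)
    simp only [smul_eq_mul]
    rw [hp]
  have hfin : IsFiniteMeasure ν := by
    have h0 := hint 0
    simp only [pow_zero] at h0
    exact (integrable_const_iff_isFiniteMeasure one_ne_zero).1 h0
  have hnn : ∀ᵐ y ∂ν, 0 ≤ y := by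
    rw [hν, ae_map_iff hφ.aemeasurable measurableSet_Ici]
    exact (withDensity_absolutelyContinuous τ d).ae_le ((hμ.ae_beta_prod ha ha1).mono fun p hp =>
      mul_nonneg (Real.rpow_nonneg hp.1.1.le _) hp.2)
  have heq : μ = ν := Measure.ext_of_moments hμ.nonneg hnn hμ.integrable_pow hint
    (fun n => by rw [hμ.moment, hmom]) fun K hK => hμ.summable_moments ha hK
  conv_rhs => rw [heq]
  rw [hν, integral_map hφ.aemeasurable hg.aestronglyMeasurable,
    integral_withDensity_eq_integral_toReal_smul hdm hdlt]
  refine integral_congr_ae (hdr.mono fun p hp => ?_)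
  dsimp only
  rw [hp, Complex.real_smul]

end IsMittagLefflerLaw

/-! ### Caputo derivatives of Mittag-Leffler averages -/

/-- The mixture formulas hold for nonnegative arguments only; derivatives are used only at positive
points, so this is enough. -/
theorem caputoDeriv_congr {a : ℝ} {f g : ℝ → ℂ} {t : ℝ} (ht : 0 < t)
    (h : ∀ x, 0 ≤ x → f x = g x) : caputoDeriv a f t = caputoDeriv a g t := by
  have hd : ∀ x, 0 < x → deriv f x = deriv g x := fun x hx =>
    Filter.EventuallyEq.deriv_eq ((lt_mem_nhds hx).mono fun y hy => h y hy.le)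
  unfold caputoDeriv
  split_ifs
  · exact hd t ht
  · congr 1
    rw [intervalIntegral.integral_of_le ht.le, intervalIntegral.integral_of_le ht.le]
    exact setIntegral_congr_fun measurableSet_Ioc fun x hx => by simp only [hd x hx.1]

theorem CaputoDifferentiableAt.congr {a : ℝ} {f g : ℝ → ℂ} {t : ℝ} (ht : 0 < t)
    (hg : CaputoDifferentiableAt a g t) (h : ∀ x, 0 ≤ x → f x = g x) :
    CaputoDifferentiableAt a f t := by
  have hev : ∀ x, 0 < x → f =ᶠ[𝓝 x] g := fun x hx => (lt_mem_nhds hx).mono fun y hy => h y hy.le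
  unfold CaputoDifferentiableAt at hg ⊢
  split_ifs at hg ⊢
  · exact hg.congr_of_eventuallyEq (hev t ht)
  · obtain ⟨h1, h2, h3⟩ := hg
    refine ⟨h1.congr fun x hx => h x hx.1,
      fun x hx => (h2 x hx).congr_of_eventuallyEq (hev x hx.1), h3.congr ?_⟩
    rw [Set.uIoc_of_le ht.le]
    exact fun x hx => by simp only [(hev x hx.1).deriv_eq]

namespace IsMittagLefflerLaw

variable {a : ℝ} {μ : Measure ℝ}

theorem integrable_self (hμ : IsMittagLefflerLaw a μ) : Integrable (fun x : ℝ => x) μ := by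
  simpa using hμ.integrable_pow 1

variable {Ψ Ψ' : ℝ → ℂ} {C : ℝ}

theorem continuousOn_integral_comp (hμ : IsMittagLefflerLaw a μ) (ha : 0 < a)
    (hΨ : Continuous Ψ) (hC : 0 ≤ C) (hb : ∀ x, 0 ≤ x → ‖Ψ x‖ ≤ C * (1 + x)) (t : ℝ) :
    ContinuousOn (fun σ : ℝ => ∫ x, Ψ (σ ^ a * x) ∂μ) (Set.Icc 0 t) := by
  have := hμ.isProbabilityMeasure
  refine continuousOn_of_dominated (bound := fun x => C * (1 + t ^ a * x)) (fun σ _ => by fun_prop)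
    (fun σ hσ => hμ.nonneg.mono fun x hx => ?_)
    (((integrable_const 1).add (hμ.integrable_self.const_mul _)).const_mul C)
    (ae_of_all _ fun x => Continuous.continuousOn ?_)
  · have h0 := hσ.1
    have h1 : σ ^ a ≤ t ^ a := Real.rpow_le_rpow hσ.1 hσ.2 ha.le
    refine (hb _ (mul_nonneg (Real.rpow_nonneg h0 _) hx)).trans ?_
    gcongr
  · exact hΨ.comp ((Real.continuous_rpow_const ha.le).mul continuous_const)

/-- Linear growth is allowed because the second fractional derivative is applied to a function of
the form `y` times a bounded one. -/
theorem hasDerivAt_integral_comp (hμ : IsMittagLefflerLaw a μ) (ha : 0 < a) (ha1 : a ≤ 1)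
    (hd : ∀ x, HasDerivAt Ψ (Ψ' x) x) (hC : 0 ≤ C) (hb : ∀ x, 0 ≤ x → ‖Ψ x‖ ≤ C * (1 + x))
    (hb' : ∀ x, 0 ≤ x → ‖Ψ' x‖ ≤ C * (1 + x)) {σ : ℝ} (hσ : 0 < σ) :
    HasDerivAt (fun σ : ℝ => ∫ x, Ψ (σ ^ a * x) ∂μ)
      (∫ x, ((a * σ ^ (a - 1) * x : ℝ) : ℂ) * Ψ' (σ ^ a * x) ∂μ) σ := by
  have := hμ.isProbabilityMeasure
  have hΨ : Continuous Ψ := continuous_iff_continuousAt.2 fun x => (hd x).continuousAt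
  have hΨ' : Measurable Ψ' := by
    rw [← show deriv Ψ = Ψ' from funext fun x => (hd x).deriv]; exact measurable_deriv Ψ
  refine (hasDerivAt_integral_of_dominated_loc_of_deriv_le
    -- The neighbourhood stays away from `0`, where `σ ^ (a - 1)` is unbounded for `a < 1`.
    (s := Set.Ioo (σ / 2) (2 * σ)) (F := fun (σ : ℝ) x => Ψ (σ ^ a * x))
    (F' := fun (σ : ℝ) x => ((a * σ ^ (a - 1) * x : ℝ) : ℂ) * Ψ' (σ ^ a * x))
    (bound := fun x => a * (σ / 2) ^ (a - 1) * C * (x + (2 * σ) ^ a * x ^ 2))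
    (Ioo_mem_nhds (by linarith) (by linarith))
    (Eventually.of_forall fun σ => by fun_prop) ?_ ?_ ?_ ?_ ?_).2
  · refine Integrable.mono' (((integrable_const 1).add
      (hμ.integrable_self.const_mul (σ ^ a))).const_mul C) (by fun_prop)
      (hμ.nonneg.mono fun x hx => ?_)
    exact hb _ (mul_nonneg (Real.rpow_nonneg hσ.le _) hx)
  · refine Measurable.aestronglyMeasurable ?_
    have : Measurable fun x => Ψ' (σ ^ a * x) := hΨ'.comp (by fun_prop)
    fun_prop
  · refine hμ.nonneg.mono fun x hx y hy => ?_
    have hy0 : 0 < y := by linarith [hy.1]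
    have h1 : y ^ (a - 1) ≤ (σ / 2) ^ (a - 1) :=
      Real.rpow_le_rpow_of_nonpos (by linarith) hy.1.le (by linarith)
    have h2 : y ^ a ≤ (2 * σ) ^ a := Real.rpow_le_rpow hy0.le hy.2.le ha.le
    rw [norm_mul, Complex.norm_real, Real.norm_eq_abs, abs_of_nonneg (by positivity)]
    calc a * y ^ (a - 1) * x * ‖Ψ' (y ^ a * x)‖
        ≤ a * (σ / 2) ^ (a - 1) * x * (C * (1 + (2 * σ) ^ a * x)) := by
          have h3 : ‖Ψ' (y ^ a * x)‖ ≤ C * (1 + (2 * σ) ^ a * x) :=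
            (hb' _ (by positivity)).trans (by gcongr)
          gcongr
      _ = _ := by ring
  · exact ((hμ.integrable_self.add ((hμ.integrable_pow 2).const_mul _))).const_mul _
  · refine ae_of_all _ fun x y hy => ?_
    have hy0 : 0 < y := by linarith [hy.1]
    have h1 : HasDerivAt (fun y : ℝ => y ^ a * x) (a * y ^ (a - 1) * x) y :=
      (Real.hasDerivAt_rpow_const (Or.inl hy0.ne')).mul_const x
    have h2 := (hd (y ^ a * x)).scomp y h1
    rwa [Complex.real_smul] at h2

theorem integrable_beta_prod (hμ : IsMittagLefflerLaw a μ) (ha : 0 < a) (ha1 : a < 1)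
    (hΨ' : Measurable Ψ') (hC : 0 ≤ C) (hb' : ∀ x, 0 ≤ x → ‖Ψ' x‖ ≤ C * (1 + x)) :
    Integrable (fun p : ℝ × ℝ => (p.2 : ℂ) * Ψ' (p.1 ^ a * p.2))
      ((betaMeasure a (1 - a)).prod μ) := by
  have := hμ.isProbabilityMeasure
  have := isProbabilityMeasureBeta ha (sub_pos.2 ha1)
  have hI : Integrable (fun x : ℝ => C * (x + x ^ 2)) μ :=
    (hμ.integrable_self.add (hμ.integrable_pow 2)).const_mul C
  refine Integrable.mono' (hI.comp_snd (betaMeasure a (1 - a))) ?_ ?_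
  · have hφ : Measurable fun p : ℝ × ℝ => p.1 ^ a * p.2 :=
      (measurable_fst.pow_const a).mul measurable_snd
    have := hΨ'.comp hφ
    exact (Measurable.mul (by fun_prop) this).aestronglyMeasurable
  · refine (hμ.ae_beta_prod ha ha1).mono fun p hp => ?_
    have h2 := hp.2
    have h3 : p.1 ^ a ≤ 1 := Real.rpow_le_one hp.1.1.le hp.1.2.le ha.le
    have h4 : 0 ≤ p.1 ^ a := Real.rpow_nonneg hp.1.1.le _
    rw [norm_mul, Complex.norm_real, Real.norm_eq_abs, abs_of_nonneg h2]
    calc p.2 * ‖Ψ' (p.1 ^ a * p.2)‖ ≤ p.2 * (C * (1 + 1 * p.2)) := by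
          have : ‖Ψ' (p.1 ^ a * p.2)‖ ≤ C * (1 + 1 * p.2) :=
            (hb' _ (by positivity)).trans (by gcongr)
          gcongr
      _ = _ := by ring

/-- Under `v = s u` the factor `v^{a-1}` of the derivative and the kernel `(s - v)^{-a}` combine
into the Beta(`a`, `1 - a`) density. -/
theorem deriv_div_rpow_eq (hμ : IsMittagLefflerLaw a μ) (ha : 0 < a) (ha1 : a < 1)
    (hd : ∀ x, HasDerivAt Ψ (Ψ' x) x) (hC : 0 ≤ C) (hb : ∀ x, 0 ≤ x → ‖Ψ x‖ ≤ C * (1 + x))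
    (hb' : ∀ x, 0 ≤ x → ‖Ψ' x‖ ≤ C * (1 + x)) {s : ℝ} (hs : 0 < s) {u : ℝ}
    (hu : u ∈ Set.Ioo (0 : ℝ) 1) :
    deriv (fun σ : ℝ => ∫ x, Ψ (σ ^ a * x) ∂μ) (s * u) / (((s - s * u) ^ a : ℝ) : ℂ) =
      ((a * s⁻¹ * beta a (1 - a) : ℝ) : ℂ) *
        (betaPDFReal a (1 - a) u • ∫ x, (x : ℂ) * Ψ' (s ^ a * (u ^ a * x)) ∂μ) := by
  have hu0 := hu.1
  have hu1 : 0 < 1 - u := sub_pos.2 hu.2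
  have hB := beta_pos ha (sub_pos.2 ha1)
  have e : ∀ x : ℝ, ((a * (s * u) ^ (a - 1) * x : ℝ) : ℂ) * Ψ' ((s * u) ^ a * x) =
      ((a * (s * u) ^ (a - 1) : ℝ) : ℂ) * ((x : ℂ) * Ψ' (s ^ a * (u ^ a * x))) := by
    intro x
    rw [Real.mul_rpow hs.le hu0.le (z := a)]
    push_cast; ring_nf
  rw [(hμ.hasDerivAt_integral_comp ha ha1.le hd hC hb hb' (mul_pos hs hu0)).deriv]
  simp_rw [e]
  rw [integral_const_mul, Complex.real_smul, ← mul_assoc, mul_div_right_comm, ← Complex.ofReal_div,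
    ← Complex.ofReal_mul]
  congr 2
  rw [betaPDFReal, if_pos (by exact hu), show s - s * u = s * (1 - u) by ring, Real.mul_rpow hs.le hu1.le,
    Real.mul_rpow hs.le hu0.le, Real.rpow_sub_one hs.ne', show 1 - a - 1 = -a by ring,
    Real.rpow_neg hu1.le]
  have h1 : 0 < s ^ a := by positivity
  have h2 : 0 < (1 - u) ^ a := by positivity
  field_simp

/-- For `A` with the Mittag-Leffler law of index `a`, the Caputo derivative of order `a` of
`σ ↦ E Ψ(σ ^ a A)` is `E Ψ'(σ ^ a A)`. -/
theorem caputo_integral_comp (hμ : IsMittagLefflerLaw a μ) (ha : 0 < a) (ha1 : a ≤ 1)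
    (hd : ∀ x, HasDerivAt Ψ (Ψ' x) x) (hC : 0 ≤ C) (hb : ∀ x, 0 ≤ x → ‖Ψ x‖ ≤ C * (1 + x))
    (hb' : ∀ x, 0 ≤ x → ‖Ψ' x‖ ≤ C * (1 + x)) {s : ℝ} (hs : 0 < s) :
    CaputoDifferentiableAt a (fun σ : ℝ => ∫ x, Ψ (σ ^ a * x) ∂μ) s ∧
      caputoDeriv a (fun σ : ℝ => ∫ x, Ψ (σ ^ a * x) ∂μ) s = ∫ x, Ψ' (s ^ a * x) ∂μ := by
  have hΨ : Continuous Ψ := continuous_iff_continuousAt.2 fun x => (hd x).continuousAt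
  have hΨ' : Measurable Ψ' := by
    rw [← show deriv Ψ = Ψ' from funext fun x => (hd x).deriv]; exact measurable_deriv Ψ
  rcases eq_or_ne a 1 with rfl | hne
  · have hD := hμ.hasDerivAt_integral_comp ha ha1 hd hC hb hb' hs
    rw [CaputoDifferentiableAt, caputoDeriv, if_pos rfl, if_pos rfl, hD.deriv]
    refine ⟨hD.differentiableAt, ?_⟩
    -- For index `1` the law is the unit mass at `1`, and the claim is the ordinary derivative.
    rw [hμ.unique isMittagLefflerLaw_dirac_one one_pos]
    simp
  replace ha1 : a < 1 := lt_of_le_of_ne ha1 hne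
  have h1a : 0 < 1 - a := sub_pos.2 ha1
  have := hμ.isProbabilityMeasure
  have := isProbabilityMeasureBeta ha h1a
  set f : ℝ → ℂ := fun σ : ℝ => ∫ x, Ψ (σ ^ a * x) ∂μ with hf
  set D : ℝ → ℂ := fun v => deriv f v / (((s - v) ^ a : ℝ) : ℂ) with hD
  set g : ℝ → ℂ := fun y => Ψ' (s ^ a * y) with hg
  have hgm : Measurable g := hΨ'.comp (by fun_prop)
  have hsa : 0 ≤ s ^ a := by positivity
  have hgb : ∀ y, 0 ≤ y → ‖g y‖ ≤ (C * (1 + s ^ a)) * (1 + y) := by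
    intro y hy
    refine (hb' _ (by positivity)).trans ?_
    rw [mul_assoc]
    gcongr
    nlinarith
  have hprod := hμ.integrable_beta_prod ha ha1 hgm (C := C * (1 + s ^ a)) (by positivity) hgb
  have hDeq : ∀ u ∈ Set.Ioo (0 : ℝ) 1, D (s * u) = ((a * s⁻¹ * beta a (1 - a) : ℝ) : ℂ) *
      (betaPDFReal a (1 - a) u • ∫ x, (x : ℂ) * g (u ^ a * x) ∂μ) := fun u hu =>
    hμ.deriv_div_rpow_eq ha ha1 hd hC hb hb' hs hu
  have hpdf := (integrable_betaMeasure_iff ha h1a).1 hprod.integral_prod_left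
  have hDint : IntervalIntegrable D volume 0 s := by
    have h1 : IntervalIntegrable (fun u => D (s * u)) volume (0 / s) (s / s) := by
      rw [zero_div, div_self hs.ne', intervalIntegrable_iff_integrableOn_Ioo_of_le zero_le_one]
      exact (hpdf.const_mul _).integrableOn.congr_fun (fun u hu => (hDeq u hu).symm)
        measurableSet_Ioo
    exact (IntervalIntegrable.comp_mul_left_iff hs.ne').1 h1
  refine ⟨?_, ?_⟩
  · rw [CaputoDifferentiableAt, if_neg hne]
    exact ⟨hμ.continuousOn_integral_comp ha hΨ hC hb s, fun x hx =>
      (hμ.hasDerivAt_integral_comp ha ha1.le hd hC hb hb' hx.1).differentiableAt, hDint⟩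
  · rw [caputoDeriv, if_neg hne]
    have h1 : ∫ v in (0 : ℝ)..s, D v = (s : ℂ) * ∫ u in (0 : ℝ)..1, D (s * u) := by
      have := intervalIntegral.smul_integral_comp_mul_left (a := 0) (b := 1) D s
      rw [mul_zero, mul_one] at this
      rw [← this, Complex.real_smul]
    have h2 : ∫ u in (0 : ℝ)..1, D (s * u) = ((a * s⁻¹ * beta a (1 - a) : ℝ) : ℂ) *
        ∫ u, ∫ x, (x : ℂ) * g (u ^ a * x) ∂μ ∂(betaMeasure a (1 - a)) := by
      rw [intervalIntegral.integral_of_le zero_le_one, integral_Ioc_eq_integral_Ioo,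
        setIntegral_congr_fun measurableSet_Ioo hDeq, integral_const_mul,
        integral_betaMeasure ha h1a]
      congr 1
      refine setIntegral_eq_integral_of_forall_compl_eq_zero fun u hu => ?_
      rw [betaPDFReal, if_neg (by exact hu), zero_smul]
    have h3 := hμ.integral_beta_prod ha ha1 hgm
    have e : ∀ p : ℝ × ℝ, ((Real.Gamma (a + 1) * p.2 : ℝ) : ℂ) * g (p.1 ^ a * p.2) =
        ((Real.Gamma (a + 1) : ℝ) : ℂ) * ((p.2 : ℂ) * g (p.1 ^ a * p.2)) := fun p => by
      push_cast; ring
    simp_rw [e] at h3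
    rw [integral_const_mul, integral_prod _ hprod] at h3
    change _ * ∫ v in (0 : ℝ)..s, D v = _
    rw [h1, h2, ← h3, ← mul_assoc, ← mul_assoc, ← Complex.ofReal_mul, ← Complex.ofReal_mul]
    -- It remains to match constants: `Γ(1-a)⁻¹ · s · a s⁻¹ B(a, 1-a) = a Γ(a) = Γ(a+1)`.
    congr 2
    have g1 := (Real.Gamma_pos_of_pos h1a).ne'
    rw [beta, add_sub_cancel, Real.Gamma_one, Real.Gamma_add_one ha.ne']
    field_simp

end IsMittagLefflerLaw

/-! ### The fractional differential equation -/

namespace IsMittagLefflerLaw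

variable {a b : ℝ} {μ ν : Measure ℝ}

/-- Exponential moments of all orders make the transform entire, so the derivative exists at every
real `y`, as `caputo_integral_comp` requires. -/
theorem hasDerivAt_complexMGF_mul (hμ : IsMittagLefflerLaw a μ) (ha : 0 < a) (w : ℂ) (y : ℝ) :
    HasDerivAt (fun y : ℝ => complexMGF id μ (w * y))
      (w * ∫ x : ℝ, (x : ℂ) * Complex.exp (w * y * x) ∂μ) y := by
  have h1 : HasDerivAt (complexMGF id μ) (∫ x : ℝ, (x : ℂ) * Complex.exp (w * y * x) ∂μ) (w * y) :=
    hasDerivAt_complexMGF (by rw [hμ.integrableExpSet_eq ha, interior_univ]; trivial)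
  have h2 : HasDerivAt (fun y : ℝ => w * (y : ℂ)) w y := by
    simpa using (Complex.ofRealCLM.hasDerivAt (x := y)).const_mul w
  rw [mul_comm w]
  exact h1.comp y h2

theorem norm_complexMGF_le_one (hμ : IsMittagLefflerLaw a μ) {w : ℂ} (hw : w.re ≤ 0) :
    ‖complexMGF id μ w‖ ≤ 1 := by
  have := hμ.isProbabilityMeasure
  refine (norm_integral_le_of_norm_le_const (hμ.nonneg.mono fun x hx =>
    norm_cexp_mul_ofReal_le_one hw hx)).trans ?_
  simp

theorem norm_integral_mul_cexp_le (hμ : IsMittagLefflerLaw a μ) {w : ℂ} (hw : w.re ≤ 0) :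
    ‖∫ x : ℝ, (x : ℂ) * Complex.exp (w * x) ∂μ‖ ≤ ∫ x, x ∂μ := by
  refine norm_integral_le_of_norm_le hμ.integrable_self (hμ.nonneg.mono fun x hx => ?_)
  rw [norm_mul, Complex.norm_real, Real.norm_eq_abs, abs_of_nonneg hx]
  exact mul_le_of_le_one_right hx (norm_cexp_mul_ofReal_le_one hw hx)

theorem integral_self_nonneg (hμ : IsMittagLefflerLaw a μ) : 0 ≤ ∫ x, x ∂μ :=
  integral_nonneg_of_ae hμ.nonneg

theorem integrable_prod_cexp (hμ : IsMittagLefflerLaw a μ) (hν : IsMittagLefflerLaw b ν) {w : ℂ}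
    (hw : w.re ≤ 0) :
    Integrable (fun p : ℝ × ℝ => Complex.exp (w * ((p.1 * p.2 : ℝ) : ℂ))) (μ.prod ν) := by
  have := hμ.isProbabilityMeasure
  have := hν.isProbabilityMeasure
  exact Integrable.of_bound (by fun_prop) 1 ((hμ.ae_prod_nonneg hν).mono fun p hp =>
    norm_cexp_mul_ofReal_le_one hw (mul_nonneg hp.1 hp.2))

theorem integrable_prod_mul_cexp (hμ : IsMittagLefflerLaw a μ) (hν : IsMittagLefflerLaw b ν) {w : ℂ}
    (hw : w.re ≤ 0) : Integrable (fun p : ℝ × ℝ => ((p.1 * p.2 : ℝ) : ℂ) *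
      Complex.exp (w * ((p.1 * p.2 : ℝ) : ℂ))) (μ.prod ν) := by
  refine Integrable.mono' (g := fun p => p.1 * p.2) (by simpa using hμ.integrable_prod_pow hν 1)
    (by fun_prop) ((hμ.ae_prod_nonneg hν).mono fun p hp => ?_)
  have h := mul_nonneg hp.1 hp.2
  rw [norm_mul, Complex.norm_real, Real.norm_eq_abs, abs_of_nonneg h]
  exact mul_le_of_le_one_right h (norm_cexp_mul_ofReal_le_one hw h)

theorem re_mul_ofReal_nonpos {c : ℂ} (hc : c.re ≤ 0) {r : ℝ} (hr : 0 ≤ r) :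
    (c * (r : ℂ)).re ≤ 0 := by
  rw [Complex.re_mul_ofReal]
  exact mul_nonpos_of_nonpos_of_nonneg hc hr

/-- Integrating out the second factor `B` first leaves `E Ψ(σ^a A)` with `Ψ(y) = E exp(w y B)`.
After the derivative the order of integration is exchanged, which prepares the same step in the
other variable. -/
theorem caputo_left (hμ : IsMittagLefflerLaw a μ) (hν : IsMittagLefflerLaw b ν) (ha : 0 < a)
    (ha1 : a ≤ 1) (hb : 0 < b) {w : ℂ} (hw : w.re ≤ 0) {f : ℝ → ℂ}
    (hf : ∀ σ : ℝ, 0 ≤ σ → f σ =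
      ∫ p, Complex.exp (w * (σ ^ a : ℝ) * ((p.1 * p.2 : ℝ) : ℂ)) ∂(μ.prod ν))
    {s : ℝ} (hs : 0 < s) :
    CaputoDifferentiableAt a f s ∧ caputoDeriv a f s =
      ∫ y : ℝ, w * y * complexMGF id μ (w * (s ^ a : ℝ) * y) ∂ν := by
  have := hμ.isProbabilityMeasure
  have := hν.isProbabilityMeasure
  have hm := hν.integral_self_nonneg
  have hre : ∀ y : ℝ, 0 ≤ y → (w * (y : ℂ)).re ≤ 0 := fun y hy => re_mul_ofReal_nonpos hw hy
  have hfe : ∀ σ : ℝ, 0 ≤ σ → f σ = ∫ x, complexMGF id ν (w * ((σ ^ a * x : ℝ) : ℂ)) ∂μ := by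
    intro σ hσ
    have hσa : 0 ≤ σ ^ a := Real.rpow_nonneg hσ a
    rw [hf σ hσ, integral_prod _ (hμ.integrable_prod_cexp hν (hre _ hσa))]
    refine integral_congr_ae (ae_of_all _ fun x => integral_congr_ae (ae_of_all _ fun y => ?_))
    simp only [id]
    push_cast; ring_nf
  have key := hμ.caputo_integral_comp (C := 1 + ‖w‖ * ∫ x, x ∂ν) ha ha1
    (fun y => hν.hasDerivAt_complexMGF_mul hb w y) (by positivity)
    (fun y hy => (hν.norm_complexMGF_le_one (hre y hy)).trans ?_) (fun y hy => ?_) hs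
  · refine ⟨key.1.congr hs hfe, ?_⟩
    rw [caputoDeriv_congr hs hfe, key.2]
    have hI : Integrable (fun p : ℝ × ℝ => w * ((p.2 : ℂ) *
        Complex.exp (w * ((s ^ a * p.1 : ℝ) : ℂ) * p.2))) (μ.prod ν) := by
      refine Integrable.const_mul ?_ _
      refine Integrable.mono' (hν.integrable_self.comp_snd μ) (by fun_prop)
        ((hμ.ae_prod_nonneg hν).mono fun p hp => ?_)
      rw [norm_mul, Complex.norm_real, Real.norm_eq_abs, abs_of_nonneg hp.2]
      have h1 := hp.1
      exact mul_le_of_le_one_right hp.2 (norm_cexp_mul_ofReal_le_one (hre _ (by positivity)) hp.2)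
    simp_rw [← integral_const_mul]
    rw [integral_integral_swap hI]
    refine integral_congr_ae (ae_of_all _ fun y => ?_)
    simp only [complexMGF, id]
    rw [← integral_const_mul]
    refine integral_congr_ae (ae_of_all _ fun x => ?_)
    push_cast; ring_nf
  · have h0 : 0 ≤ ‖w‖ * ∫ x, x ∂ν := by positivity
    nlinarith
  · rw [norm_mul]
    have h1 := mul_le_mul_of_nonneg_left (hν.norm_integral_mul_cexp_le (hre y hy)) (norm_nonneg w)
    have h0 : 0 ≤ ‖w‖ * ∫ x, x ∂ν := by positivity
    nlinarith

/-- The first derivative is `E Ψ(τ^b B)` with `Ψ(y) = c y E exp(c s^a y A)`. The product rule for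
`Ψ` produces the two terms of the result. -/
theorem caputo_caputo (hμ : IsMittagLefflerLaw a μ) (hν : IsMittagLefflerLaw b ν) (ha : 0 < a)
    (ha1 : a ≤ 1) (hb : 0 < b) (hb1 : b ≤ 1) {c : ℂ} (hc : c.re ≤ 0) {F : ℝ → ℝ → ℂ}
    (hF : ∀ σ τ : ℝ, 0 ≤ σ → 0 ≤ τ → F σ τ = ∫ p, Complex.exp (c * (σ ^ a : ℝ) * (τ ^ b : ℝ) *
      ((p.1 * p.2 : ℝ) : ℂ)) ∂(μ.prod ν)) {s t : ℝ} (hs : 0 < s) (ht : 0 < t) :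
    (∀ τ : ℝ, 0 ≤ τ → CaputoDifferentiableAt a (fun σ => F σ τ) s) ∧
    CaputoDifferentiableAt b (fun τ => caputoDeriv a (fun σ => F σ τ) s) t ∧
    caputoDeriv b (fun τ => caputoDeriv a (fun σ => F σ τ) s) t =
      c * F s t + c ^ 2 * ((s ^ a * t ^ b : ℝ) : ℂ) * ∫ p, ((p.1 * p.2 : ℝ) : ℂ) *
        Complex.exp (c * (s ^ a : ℝ) * (t ^ b : ℝ) * ((p.1 * p.2 : ℝ) : ℂ)) ∂(μ.prod ν) := by
  have := hμ.isProbabilityMeasure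
  have := hν.isProbabilityMeasure
  have hsa : 0 ≤ s ^ a := by positivity
  have htb : 0 ≤ t ^ b := by positivity
  have hm := hμ.integral_self_nonneg
  have hre : ∀ y : ℝ, 0 ≤ y → (c * (s ^ a : ℝ) * (y : ℂ)).re ≤ 0 := fun y hy =>
    re_mul_ofReal_nonpos (re_mul_ofReal_nonpos hc hsa) hy
  have h1 : ∀ τ : ℝ, 0 ≤ τ → _ := fun τ hτ =>
    hμ.caputo_left hν ha ha1 hb (w := c * (τ ^ b : ℝ)) (f := fun σ => F σ τ)
      (re_mul_ofReal_nonpos hc (Real.rpow_nonneg hτ b))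
      (fun σ hσ => by rw [hF σ τ hσ hτ, mul_right_comm c]) hs
  have hfe : ∀ τ : ℝ, 0 ≤ τ → caputoDeriv a (fun σ => F σ τ) s =
      ∫ y : ℝ, c * ((τ ^ b * y : ℝ) : ℂ) *
        complexMGF id μ (c * (s ^ a : ℝ) * ((τ ^ b * y : ℝ) : ℂ)) ∂ν := by
    intro τ hτ
    rw [(h1 τ hτ).2]
    refine integral_congr_ae (ae_of_all _ fun y => ?_)
    dsimp only
    push_cast; ring_nf
  have hd : ∀ y : ℝ, HasDerivAt
      (fun y : ℝ => c * (y : ℂ) * complexMGF id μ (c * (s ^ a : ℝ) * (y : ℂ)))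
      (c * complexMGF id μ (c * (s ^ a : ℝ) * (y : ℂ)) + c * (y : ℂ) * (c * (s ^ a : ℝ) *
        ∫ x : ℝ, (x : ℂ) * Complex.exp (c * (s ^ a : ℝ) * y * x) ∂μ)) y := by
    intro y
    have h2 : HasDerivAt (fun y : ℝ => c * (y : ℂ)) c y := by
      simpa using (Complex.ofRealCLM.hasDerivAt (x := y)).const_mul c
    exact h2.mul (hμ.hasDerivAt_complexMGF_mul ha _ y)
  have hC0 : 0 ≤ ‖c‖ * (‖c‖ * s ^ a * ∫ x, x ∂μ) := by positivity
  -- The summand `‖c‖` bounds `Ψ(y) / y` and the first term of `Ψ'`; the other bounds the second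
  -- term of `Ψ'` divided by `y`.
  have key := hν.caputo_integral_comp (C := ‖c‖ + ‖c‖ * (‖c‖ * s ^ a * ∫ x, x ∂μ)) hb hb1
    hd (by positivity) (fun y hy => ?_) (fun y hy => ?_) ht
  · refine ⟨fun τ hτ => (h1 τ hτ).1, key.1.congr ht hfe, ?_⟩
    have hw : (c * (s ^ a : ℝ) * (t ^ b : ℝ)).re ≤ 0 := hre _ htb
    rw [caputoDeriv_congr ht hfe, key.2, hF s t hs.le ht.le,
      integral_prod_symm _ (hμ.integrable_prod_cexp hν hw),
      integral_prod_symm _ (hμ.integrable_prod_mul_cexp hν hw), ← integral_const_mul,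
      ← integral_const_mul, ← integral_add]
    · refine integral_congr_ae (ae_of_all _ fun y => ?_)
      simp only [complexMGF, id]
      congr 1
      · congr 2; ext x
        push_cast; ring_nf
      · rw [← integral_const_mul, ← integral_const_mul, ← integral_const_mul]
        congr 1; ext x
        push_cast; ring_nf
    · exact ((hμ.integrable_prod_cexp hν hw).integral_prod_right).const_mul _
    · exact ((hμ.integrable_prod_mul_cexp hν hw).integral_prod_right).const_mul _
  · have h2 := hμ.norm_complexMGF_le_one (hre y hy)
    rw [norm_mul, norm_mul, Complex.norm_real, Real.norm_eq_abs, abs_of_nonneg hy]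
    have h3 : ‖c‖ * y * ‖complexMGF id μ (c * (s ^ a : ℝ) * (y : ℂ))‖ ≤ ‖c‖ * y * 1 := by gcongr
    nlinarith [norm_nonneg c]
  · have h2 := hμ.norm_complexMGF_le_one (hre y hy)
    have h3 := hμ.norm_integral_mul_cexp_le (hre y hy)
    refine (norm_add_le _ _).trans ?_
    simp only [norm_mul, Complex.norm_real, Real.norm_eq_abs, abs_of_nonneg hy, abs_of_nonneg hsa]
    have h4 : ‖c‖ * ‖complexMGF id μ (c * (s ^ a : ℝ) * (y : ℂ))‖ ≤ ‖c‖ * 1 := by gcongr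
    have h5 : ‖c‖ * y * (‖c‖ * s ^ a *
        ‖∫ x : ℝ, (x : ℂ) * Complex.exp (c * (s ^ a : ℝ) * y * x) ∂μ‖) ≤
        ‖c‖ * y * (‖c‖ * s ^ a * ∫ x, x ∂μ) := by gcongr
    nlinarith [mul_nonneg (norm_nonneg c) hy]

/-- Serves the derivative in `λ₁`, with direction `e = z - 1` and `r = s^α t^β`. The sign condition
near `y₀` gives the dominating function `‖e r‖ p.1 p.2`. -/
theorem hasDerivAt_integral_prod_cexp (hμ : IsMittagLefflerLaw a μ) (hν : IsMittagLefflerLaw b ν)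
    {c e : ℂ} {y₀ r : ℝ} (hr : 0 ≤ r)
    (hre : ∀ᶠ y : ℝ in 𝓝 y₀, (c + ((y - y₀ : ℝ) : ℂ) * e).re ≤ 0) :
    HasDerivAt (fun y : ℝ => ∫ p, Complex.exp ((c + ((y - y₀ : ℝ) : ℂ) * e) * r *
        ((p.1 * p.2 : ℝ) : ℂ)) ∂(μ.prod ν))
      (e * r * ∫ p, ((p.1 * p.2 : ℝ) : ℂ) * Complex.exp (c * r * ((p.1 * p.2 : ℝ) : ℂ))
        ∂(μ.prod ν)) y₀ := by
  have h0 := hre.self_of_nhds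
  have h := (hasDerivAt_integral_of_dominated_loc_of_deriv_le (μ := μ.prod ν) hre
    (F := fun (y : ℝ) p => Complex.exp ((c + ((y - y₀ : ℝ) : ℂ) * e) * r * ((p.1 * p.2 : ℝ) : ℂ)))
    (F' := fun (y : ℝ) p => e * r * (((p.1 * p.2 : ℝ) : ℂ) *
      Complex.exp ((c + ((y - y₀ : ℝ) : ℂ) * e) * r * ((p.1 * p.2 : ℝ) : ℂ))))
    (bound := fun p => ‖e * r‖ * (p.1 * p.2))
    (Eventually.of_forall fun y => by fun_prop)
    (hμ.integrable_prod_cexp hν (re_mul_ofReal_nonpos h0 hr)) (by fun_prop) ?_ ?_ ?_).2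
  · rw [integral_const_mul] at h
    simpa using h
  · refine (hμ.ae_prod_nonneg hν).mono fun p hp y hy => ?_
    have hpp := mul_nonneg hp.1 hp.2
    rw [norm_mul, norm_mul (((p.1 * p.2 : ℝ) : ℂ)), Complex.norm_real (p.1 * p.2),
      Real.norm_eq_abs, abs_of_nonneg hpp]
    exact mul_le_mul_of_nonneg_left (mul_le_of_le_one_right hpp
      (norm_cexp_mul_ofReal_le_one (re_mul_ofReal_nonpos hy hr) hpp)) (norm_nonneg _)
  · simpa using (hμ.integrable_prod_pow hν 1).const_mul ‖e * r‖
  · refine ae_of_all _ fun p y _ => ?_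
    have h1 : HasDerivAt (fun y : ℝ => ((y - y₀ : ℝ) : ℂ)) 1 y :=
      ((hasDerivAt_id y).sub_const y₀).ofReal_comp
    have h2 := ((((h1.mul_const e).const_add c).mul_const (r : ℂ)).mul_const
      ((p.1 * p.2 : ℝ) : ℂ)).cexp
    refine h2.congr_deriv ?_
    ring

end IsMittagLefflerLaw

/-! ### Algebra of the exponent and of the double sum. -/

theorem gprfExponent_update {k : ℕ} [NeZero k] (l : Fin k → ℝ) (z : ℂ) (y : ℝ) :
    gprfExponent (Function.update l 0 y) z =
      gprfExponent l z + ((y - l 0 : ℝ) : ℂ) * (z - 1) := by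
  have h : ∀ j : Fin k, ((Function.update l 0 y j : ℝ) : ℂ) * (z ^ ((j : ℕ) + 1) - 1) =
      (l j : ℂ) * (z ^ ((j : ℕ) + 1) - 1) +
        if j = 0 then ((y - l 0 : ℝ) : ℂ) * (z - 1) else 0 := by
    intro j
    split_ifs with hj
    · subst hj
      simp only [Function.update_self, Fin.val_zero, zero_add, pow_one]
      push_cast; ring
    · rw [Function.update_of_ne hj, add_zero]
  simp only [gprfExponent]
  simp_rw [h]
  rw [Finset.sum_add_distrib, Finset.sum_ite_eq' Finset.univ (0 : Fin k), if_pos (Finset.mem_univ _)]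

/-- Each summand has the factor `z^J - 1`, and what remains is a geometric sum. -/
theorem sum_Icc_pow_sub_mul_sub_one (z : ℂ) (J J' : ℕ) :
    (∑ r ∈ Finset.Icc 1 J', (z ^ (J + J' - r) - z ^ (J' - r))) * (z - 1) =
      (z ^ J - 1) * (z ^ J' - 1) := by
  have h : ∑ r ∈ Finset.Icc 1 J', (z ^ (J + J' - r) - z ^ (J' - r)) =
      ∑ i ∈ Finset.range J', (z ^ J - 1) * z ^ i := by
    rw [← Finset.sum_range_reflect, Finset.range_eq_Ico, ← Finset.Ico_add_one_right_eq_Icc,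
      ← Finset.sum_Ico_add' _ 0 J' 1]
    refine Finset.sum_congr rfl fun i hi => ?_
    have hi' := (Finset.mem_Ico.1 hi).2
    rw [show J + J' - (i + 1) = J + (J' - 1 - i) by omega, show J' - (i + 1) = J' - 1 - i by omega,
      pow_add]
    ring
  rw [h, ← Finset.mul_sum, mul_assoc, geom_sum_mul]

/-- The double sum is `c² / (z - 1)`; the product form includes `z = 1`. -/
theorem sum_sum_mul_sub_one_eq_sq {k : ℕ} (l : Fin k → ℝ) (z : ℂ) :
    (∑ j : Fin k, ∑ j' : Fin k, (l j : ℂ) * (l j' : ℂ) *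
      ∑ r ∈ Finset.Icc 1 ((j' : ℕ) + 1),
        (z ^ (((j : ℕ) + 1) + ((j' : ℕ) + 1) - r) - z ^ (((j' : ℕ) + 1) - r))) * (z - 1) =
      gprfExponent l z ^ 2 := by
  rw [gprfExponent, sq, Finset.sum_mul_sum, Finset.sum_mul]
  refine Finset.sum_congr rfl fun j _ => ?_
  rw [Finset.sum_mul]
  refine Finset.sum_congr rfl fun j' _ => ?_
  rw [mul_assoc, sum_Icc_pow_sub_mul_sub_one]
  ring

end

/-! ### The assertions for the fractional field. -/

theorem mainTheorem3 {k : ℕ} [NeZero k] (α β : ℝ) (hα : 0 < α) (hα1 : α ≤ 1) (hβ : 0 < β)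
    (hβ1 : β ≤ 1)
    -- for every vector `l` of positive rates, a fractional field `X l` with these rates, on a
    -- probability space that may depend on `l`
    {Ω : (Fin k → ℝ) → Type*} [∀ l, MeasurableSpace (Ω l)] (P : ∀ l, Measure (Ω l))
    [∀ l, IsProbabilityMeasure (P l)] (X : ∀ l, ℝ≥0 → ℝ≥0 → Ω l → ℕ)
    (hX : ∀ l : Fin k → ℝ, (∀ j, 0 < l j) → IsFGPRF α β l (X l) (P l))
    -- a vector of positive rates, and the argument of the generating function
    (l : Fin k → ℝ) (hl : ∀ j, 0 < l j) (z : ℂ) (hz : ‖z‖ ≤ 1) :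
    -- the generating function as a function of the rates and of `(s, t)`
    let G : (Fin k → ℝ) → ℝ → ℝ → ℂ := fun l' s t => pgf (X l') (P l') z s t
    let c : ℂ := ∑ j : Fin k, (l j : ℂ) * (z ^ ((j : ℕ) + 1) - 1)
    let x : ℝ → ℝ → ℂ := fun s t => c * ((s ^ α : ℝ) : ℂ) * ((t ^ β : ℝ) : ℂ)
    -- the generating function is well defined
    (∀ s t : ℝ≥0, Integrable (fun ω => z ^ X l s t ω) (P l)) ∧
    -- it is the generalized Wright function, wherever the series of the latter converges
    (∀ s t : ℝ, 0 ≤ s → 0 ≤ t →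
      ((1 < α + β ∨ (α + β = 1 ∧ ‖x s t‖ < α ^ α * β ^ β)) →
        GenWrightConverges ![(1, 1), (1, 1)] ![(1, α), (1, β)] (x s t)) ∧
      (GenWrightConverges ![(1, 1), (1, 1)] ![(1, α), (1, β)] (x s t) →
        G l s t = genWright ![(1, 1), (1, 1)] ![(1, α), (1, β)] (x s t))) ∧
    -- the fractional differential equation, with the existence of all derivatives in it
    (∀ s t : ℝ, 0 < s → 0 < t →
      (∀ τ : ℝ, 0 ≤ τ → CaputoDifferentiableAt α (fun σ => G l σ τ) s) ∧
      CaputoDifferentiableAt β (fun τ => caputoDeriv α (fun σ => G l σ τ) s) t ∧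
      DifferentiableAt ℝ (fun y : ℝ => G (Function.update l 0 y) s t) (l 0) ∧
      caputoDeriv β (fun τ => caputoDeriv α (fun σ => G l σ τ) s) t =
        (∑ j : Fin k, (l j : ℂ) * (z ^ ((j : ℕ) + 1) - 1)) * G l s t +
        (∑ j : Fin k, ∑ j' : Fin k, (l j : ℂ) * (l j' : ℂ) *
          ∑ r ∈ Finset.Icc 1 ((j' : ℕ) + 1),
            (z ^ (((j : ℕ) + 1) + ((j' : ℕ) + 1) - r) - z ^ (((j' : ℕ) + 1) - r))) *
          deriv (fun y : ℝ => G (Function.update l 0 y) s t) (l 0)) ∧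
    -- the initial conditions
    (∀ s t : ℝ, 0 ≤ s → 0 ≤ t → G l 0 t = 1 ∧ G l s 0 = 1 ∧ G l 0 0 = 1) := by
  intro G c x
  obtain ⟨μ, ν, hμ, hν, hlaw⟩ := (hX l hl).exists_laws hl hα hβ
  have hc : c.re ≤ 0 := gprfExponent_re_nonpos hl hz
  have hG : ∀ l' : Fin k → ℝ, (∀ j, 0 < l' j) → ∀ s t : ℝ, 0 ≤ s → 0 ≤ t → G l' s t =
      ∫ p, Complex.exp (gprfExponent l' z * (s ^ α : ℝ) * (t ^ β : ℝ) *
        ((p.1 * p.2 : ℝ) : ℂ)) ∂(μ.prod ν) := by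
    intro l' hl' s t hs ht
    obtain ⟨μ', ν', hμ', hν', hlaw'⟩ := (hX l' hl').exists_laws hl' hα hβ
    -- Fields with different rates may live on different spaces, but their mixing laws coincide by
    -- uniqueness. So `G` can be differentiated in the rates under one fixed measure.
    rw [hμ.unique hμ' hα, hν.unique hν' hβ]
    have h := (hlaw' z hz s.toNNReal t.toNNReal).2
    rwa [Real.coe_toNNReal s hs, Real.coe_toNNReal t ht] at h
  have hxre : ∀ s t : ℝ, 0 ≤ s → 0 ≤ t → (x s t).re ≤ 0 := fun s t hs ht =>
    IsMittagLefflerLaw.re_mul_ofReal_nonpos (IsMittagLefflerLaw.re_mul_ofReal_nonpos hc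
      (Real.rpow_nonneg hs α)) (Real.rpow_nonneg ht β)
  have hG1 : ∀ s t : ℝ, 0 ≤ s → 0 ≤ t → s = 0 ∨ t = 0 → G l s t = 1 := by
    intro s t hs ht h
    have := hμ.isProbabilityMeasure
    have := hν.isProbabilityMeasure
    rw [hG l hl s t hs ht]
    rcases h with rfl | rfl
    · simp [Real.zero_rpow hα.ne']
    · simp [Real.zero_rpow hβ.ne']
  refine ⟨fun s t => (hlaw z hz s t).1, fun s t hs ht => ⟨fun h => ?_, fun h => ?_⟩,
    fun s t hs ht => ?_, fun s t hs ht =>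
      ⟨hG1 0 t le_rfl ht (Or.inl rfl), hG1 s 0 hs le_rfl (Or.inr rfl),
        hG1 0 0 le_rfl le_rfl (Or.inl rfl)⟩⟩
  · exact (hasSum_conditional_nat_iff.2
      (summable_genWrightTerm hα hβ h).hasSum.tendsto_sum_nat).summable
  · rw [hG l hl s t hs ht]
    exact hμ.integral_cexp_eq_genWright hν hα hβ (hxre s t hs ht) h
  obtain ⟨h1, h2, h3⟩ := hμ.caputo_caputo hν hα hα1 hβ hβ1 hc (F := G l)
    (fun σ τ hσ hτ => hG l hl σ τ hσ hτ) hs ht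
  have hupd : ∀ y : ℝ, 0 < y → ∀ j, 0 < Function.update l 0 y j := by
    intro y hy j
    rcases eq_or_ne j 0 with rfl | hj
    · rwa [Function.update_self]
    · rw [Function.update_of_ne hj]; exact hl j
  have hpos : ∀ᶠ y : ℝ in 𝓝 (l 0), 0 < y := lt_mem_nhds (hl 0)
  have hr : 0 ≤ s ^ α * t ^ β := by positivity
  have hD := (hμ.hasDerivAt_integral_prod_cexp hν (c := c) (e := z - 1) hr
    (hpos.mono fun y hy => by
      have := gprfExponent_re_nonpos (hupd y hy) hz
      rwa [gprfExponent_update] at this)).congr_of_eventuallyEq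
    (f₁ := fun y : ℝ => G (Function.update l 0 y) s t) (hpos.mono fun y hy => by
      dsimp only
      rw [hG _ (hupd y hy) s t hs.le ht.le, gprfExponent_update]
      push_cast
      simp only [← mul_assoc]
      rfl)
  refine ⟨h1, h2, hD.differentiableAt, ?_⟩
  rw [h3, hD.deriv]
  have hsq := sum_sum_mul_sub_one_eq_sq l z
  change c * G l s t + c ^ 2 * _ * _ = c * G l s t + _ * _
  -- The factor `z - 1` of the derivative in `λ₁` is moved to the double sum, completing it to `c²`.
  rw [mul_assoc (z - 1), ← mul_assoc _ (z - 1), hsq, ← mul_assoc]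
  congr 3
  ext p
  push_cast
  simp only [← mul_assoc]
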